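/- Let $d\ge 0$ and $N\ge 1$, and let $A=\bigcap_{i=1}^N A_i$ and $B=\bigcap_{i=1}^N B_i$ be nonempty polyhedra in $\mathbb{R}^d$, where each $A_i$ and each $B_i$ is a closed half-space or all of $\mathbb{R}^d$. (Allowing $\mathbb{R}^d$ itself lets the two lists have the same length; $A$ and $B$ need not be disjoint.) Extend the lists cyclically, $A_{n+N}=A_n$ and $B_{n+N}=B_n$ for $n\ge 1$, and let $P_C$ denote the metric projection onto a closed convex set $C$. Let $(\lambda_n)_{n\ge 1}$ be numbers in $[0,1]$ with $\lambda_n\to 0$, $\sum_n\lambda_n=\infty$ and $\sum_n|\lambda_n-\lambda_{n+N}|<\infty$. For $a,b,x\in\mathbb{R}^d$ put $Q_{B,0}(a;x)=x$, $Q_{A,0}(b;x)=x$ and, for $n\ge 1$, $$Q_{B,n}(a;x)=\lambda_n a+(1-\lambda_n)P_{B_n}\bigl(Q_{B,n-1}(a;x)\bigr),\qquad Q_{A,n}(b;x)=\lambda_n b+(1-\lambda_n)P_{A_n}\bigl(Q_{A,n-1}(b;x)\bigr).$$ Let $(n_k)_{k\ge 0}$ be a nondecreasing sequence of nonnegative integers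 with $$n_k\to\infty\qquad\text{and}\qquad \sup_{k_0\ge 0}\ \sum_{k>k_0}\ \prod_{n=n_{k_0}+1}^{n_k}(1-\lambda_n)<\infty .$$ Let $a_0\in\mathbb{R}^d$ be arbitrary, let $(a'_{2k},b'_{2k+1})_{k\ge 0}$ be a bounded sequence of pairs of points of $\mathbb{R}^d$, and let, for $k\ge 0$, $$b_{2k+1}=Q_{B,n_{2k}}(a_{2k};a'_{2k}),\qquad a_{2k+2}=Q_{A,n_{2k+1}}(b_{2k+1};b'_{2k+1}).$$ Then the pairs $(a_{2k},b_{2k+1})$ converge to a best approximation pair relative to $(A,B)$, that is, to a pair $(a^*,b^*)\in A\times B$ with $|a^*-b^*|=\min\{|x-y| : x\in A,\ y\in B\}$. (The best approximation pair need not be unique.) -/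

import Mathlib

open Filter Topology

/-- A closed half-space of a real inner product space: `{x | ⟪u, x⟫ ≤ c}` with `u ≠ 0`. -/
def IsClosedHalfSpace {E : Type*} [NormedAddCommGroup E] [InnerProductSpace ℝ E]
    (S : Set E) : Prop :=
  ∃ (u : E) (c : ℝ), u ≠ 0 ∧ S = {x | inner ℝ u x ≤ c}

/-- `y` is a point of `C` nearest to `x`. -/
def IsNearestPoint {E : Type*} [NormedAddCommGroup E] (C : Set E) (x y : E) : Prop :=
  y ∈ C ∧ ∀ z ∈ C, ‖x - y‖ ≤ ‖x - z‖

open Classical in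
/-- The metric projection onto `C`: the point of `C` nearest to `x`. It exists and is unique when
`C` is nonempty, closed and convex; where there is no nearest point the value is `x`. -/
noncomputable def metricProj {E : Type*} [NormedAddCommGroup E] (C : Set E) (x : E) : E :=
  if h : ∃ y, IsNearestPoint C x y then h.choose else x

/-- In a Hilbert space, the metric projection onto a nonempty closed convex set is characterized
by being a nearest point. -/
theorem metricProj_eq_iff {E : Type*} [NormedAddCommGroup E] [InnerProductSpace ℝ E]
    [CompleteSpace E] {C : Set E} (hne : C.Nonempty) (hcl : IsClosed C) (hcv : Convex ℝ C)
    (x y : E) : metricProj C x = y ↔ IsNearestPoint C x y := by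
  have key : ∀ v, IsNearestPoint C x v → v ∈ C ∧ ∀ w ∈ C, inner ℝ (x - v) (w - v) ≤ 0 := by
    intro v hv
    refine ⟨hv.1, (norm_eq_iInf_iff_real_inner_le_zero hcv hv.1).1 ?_⟩
    have : Nonempty C := hne.to_subtype
    apply le_antisymm
    · exact le_ciInf fun w => hv.2 w w.2
    · exact ciInf_le ⟨0, by rintro _ ⟨w, rfl⟩; exact norm_nonneg _⟩ (⟨v, hv.1⟩ : C)
  have uniq : ∀ v w, IsNearestPoint C x v → IsNearestPoint C x w → v = w := by
    intro v w hv hw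
    have h1 := (key v hv).2 w hw.1
    have h2 := (key w hw).2 v hv.1
    have h3 : inner ℝ (v - w) (v - w) = inner ℝ (x - v) (w - v) + inner ℝ (x - w) (v - w) := by
      simp only [inner_sub_left, inner_sub_right]
      ring
    have h4 : inner ℝ (v - w) (v - w) = (0 : ℝ) :=
      le_antisymm (by linarith) real_inner_self_nonneg
    exact sub_eq_zero.1 (inner_self_eq_zero.1 h4)
  have ex : ∃ v, IsNearestPoint C x v := by
    obtain ⟨v, hv, hv'⟩ := exists_norm_eq_iInf_of_complete_convex hne hcl.isComplete hcv x
    refine ⟨v, hv, fun z hz => ?_⟩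
    rw [hv']
    exact ciInf_le ⟨0, by rintro _ ⟨w, rfl⟩; exact norm_nonneg _⟩ (⟨z, hz⟩ : C)
  have hp : IsNearestPoint C x (metricProj C x) := by
    unfold metricProj
    rw [dif_pos ex]
    exact ex.choose_spec
  exact ⟨fun h => h ▸ hp, fun h => uniq _ _ hp h⟩

/-- `n` steps of the HLWB iteration with anchor `a` and starting point `x`:
`Q₀ = x` and `Qₙ = λₙ a + (1 - λₙ) P_{Cₙ}(Qₙ₋₁)` for `n ≥ 1`, where `C₁, …, C_N` are the given sets
repeated cyclically. They are indexed here by `Fin N`, so that `C_{n+1}` is the set with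
index `n mod N`. -/
noncomputable def hlwb {E : Type*} [NormedAddCommGroup E] [NormedSpace ℝ E] {N : ℕ} [NeZero N]
    (lam : ℕ → ℝ) (C : Fin N → Set E) (a x : E) : ℕ → E
  | 0 => x
  | n + 1 => lam (n + 1) • a +
      (1 - lam (n + 1)) • metricProj (C (Fin.ofNat N n)) (hlwb lam C a x n)

/-- The sequences `a₀, a₂, a₄, …` and `b₁, b₃, b₅, …` are a run of the alternating HLWB algorithm
with sweep lengths `nk` and auxiliary starting points `a'₀, a'₂, …` and `b'₁, b'₃, …`: for even `k`,
`b_{k+1}` is obtained from `a_k` by `nk k` steps with the sets `B`; for odd `k`, `a_{k+1}` is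
obtained from `b_k` by `nk k` steps with the sets `A`. Only the even-indexed values of `a`, `a'` and
the odd-indexed values of `b`, `b'` matter. -/
def IsAlternatingHLWB {E : Type*} [NormedAddCommGroup E] [NormedSpace ℝ E] {N : ℕ} [NeZero N]
    (lam : ℕ → ℝ) (nk : ℕ → ℕ) (A B : Fin N → Set E) (a' b' a b : ℕ → E) : Prop :=
  (∀ k, Even k → b (k + 1) = hlwb lam B (a k) (a' k) (nk k)) ∧
  (∀ k, Odd k → a (k + 1) = hlwb lam A (b k) (b' k) (nk k))

/-- `p` is a best approximation pair relative to `(A, B)`: a pair in `A × B` whose distance is the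
minimum of `‖x - y‖` over `x ∈ A`, `y ∈ B`. -/
def IsBestApproxPair {E : Type*} [NormedAddCommGroup E] (A B : Set E) (p : E × E) : Prop :=
  p.1 ∈ A ∧ p.2 ∈ B ∧ ∀ x ∈ A, ∀ y ∈ B, ‖p.1 - p.2‖ ≤ ‖x - y‖

/-!
A sweep of HLWB is nonexpansive in its anchor and, by Bauschke's theorem, converges to the
projection of the anchor. Hence the even iterates satisfy `a_{2k+2} = R_k (a_{2k})` for nonexpansive
maps `R_k` converging pointwise to `P_A ∘ P_B`. The fixed points of this composition are the first
components of the best approximation pairs, and it moves all other points strictly closer to each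
of them, so that the iterates, once bounded, approach the set of fixed points.

To see that they do not drift along this set, consider a fixed point `p` and the directions `K`
parallel to both the face of `A` at `p` and the face of `B` at `P_B p`. Near these faces the
projections onto the half-spaces do not change `K`-components, which the sweep `R_k` therefore
changes only by an amount proportional to the products of the `1 - λₙ`; these are summable over `k`.
Among the relevant fixed points (first all of them, to bound the iterates, then the cluster points
of the iterates) take `p` with the fewest active constraints. Nearby ones then lie on the same
faces, hence in `p + K`, and the iterates that come close to `p` stay close to it.
-/

/-- The sets onto which a Hilbert space has a well-defined metric projection. -/
structure IsNonemptyClosedConvex {E : Type*} [NormedAddCommGroup E] [NormedSpace ℝ E]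
    (C : Set E) : Prop where
  nonempty : C.Nonempty
  isClosed : IsClosed C
  convex : Convex ℝ C

namespace IsNonemptyClosedConvex

variable {E : Type*} [NormedAddCommGroup E]

theorem iInter [NormedSpace ℝ E] {ι : Sort*} {C : ι → Set E}
    (hC : ∀ i, IsNonemptyClosedConvex (C i)) (hne : (⋂ i, C i).Nonempty) :
    IsNonemptyClosedConvex (⋂ i, C i) :=
  ⟨hne, isClosed_iInter fun i => (hC i).isClosed, convex_iInter fun i => (hC i).convex⟩

variable [InnerProductSpace ℝ E] [CompleteSpace E] {C : Set E}

theorem isNearestPoint_metricProj (hC : IsNonemptyClosedConvex C) (x : E) :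
    IsNearestPoint C x (metricProj C x) :=
  (metricProj_eq_iff hC.nonempty hC.isClosed hC.convex x _).1 rfl

theorem metricProj_mem (hC : IsNonemptyClosedConvex C) (x : E) : metricProj C x ∈ C :=
  (hC.isNearestPoint_metricProj x).1

theorem metricProj_eq_self (hC : IsNonemptyClosedConvex C) {x : E} (hx : x ∈ C) :
    metricProj C x = x :=
  (metricProj_eq_iff hC.nonempty hC.isClosed hC.convex x x).2 ⟨hx, fun z _ => by simp⟩

theorem metricProj_eq_iff_inner_le_zero (hC : IsNonemptyClosedConvex C) {x y : E} (hy : y ∈ C) :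
    metricProj C x = y ↔ ∀ w ∈ C, inner ℝ (x - y) (w - y) ≤ 0 := by
  have : Nonempty C := ⟨y, hy⟩
  have hbdd : BddBelow (Set.range fun w : C => ‖x - w‖) :=
    ⟨0, Set.forall_mem_range.2 fun _ => norm_nonneg _⟩
  rw [metricProj_eq_iff hC.nonempty hC.isClosed hC.convex,
    ← norm_eq_iInf_iff_real_inner_le_zero hC.convex hy]
  refine ⟨fun h => le_antisymm (le_ciInf fun w => h.2 w w.2) (ciInf_le hbdd ⟨y, hy⟩),
    fun h => ⟨hy, fun z hz => ?_⟩⟩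
  exact h ▸ ciInf_le hbdd ⟨z, hz⟩

theorem inner_sub_metricProj_le_zero (hC : IsNonemptyClosedConvex C) (x : E) {w : E}
    (hw : w ∈ C) : inner ℝ (x - metricProj C x) (w - metricProj C x) ≤ 0 :=
  (hC.metricProj_eq_iff_inner_le_zero (hC.metricProj_mem x)).1 rfl w hw

theorem metricProj_firmly_nonexpansive (hC : IsNonemptyClosedConvex C) (x y : E) :
    ‖metricProj C x - metricProj C y‖ ^ 2 +
      ‖(x - metricProj C x) - (y - metricProj C y)‖ ^ 2 ≤ ‖x - y‖ ^ 2 := by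
  have hx := hC.inner_sub_metricProj_le_zero x (hC.metricProj_mem y)
  have hy := hC.inner_sub_metricProj_le_zero y (hC.metricProj_mem x)
  set u := metricProj C x
  set v := metricProj C y
  have hexpand := norm_add_sq_real (u - v) ((x - u) - (y - v))
  have hcross : inner ℝ (u - v) ((x - u) - (y - v)) =
      -inner ℝ (x - u) (v - u) - inner ℝ (y - v) (u - v) := by
    rw [inner_sub_right, real_inner_comm, real_inner_comm (y - v), ← neg_sub u v, inner_neg_right]
    ring
  rw [show u - v + (x - u - (y - v)) = x - y by abel] at hexpand
  linarith

theorem norm_metricProj_sub_metricProj_le (hC : IsNonemptyClosedConvex C) (x y : E) :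
    ‖metricProj C x - metricProj C y‖ ≤ ‖x - y‖ :=
  le_of_sq_le_sq ((le_add_of_nonneg_right (sq_nonneg _)).trans
    (hC.metricProj_firmly_nonexpansive x y)) (norm_nonneg _)

theorem norm_metricProj_sub_le (hC : IsNonemptyClosedConvex C) (x : E) {z : E} (hz : z ∈ C) :
    ‖metricProj C x - z‖ ≤ ‖x - z‖ := by
  simpa only [hC.metricProj_eq_self hz] using hC.norm_metricProj_sub_metricProj_le x z

theorem lipschitzWith_metricProj (hC : IsNonemptyClosedConvex C) :
    LipschitzWith 1 (metricProj C) :=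
  LipschitzWith.mk_one fun x y => by
    simpa only [dist_eq_norm] using hC.norm_metricProj_sub_metricProj_le x y

theorem sub_metricProj_eq_of_norm_le (hC : IsNonemptyClosedConvex C) {x y : E}
    (h : ‖x - y‖ ≤ ‖metricProj C x - metricProj C y‖) :
    x - metricProj C x = y - metricProj C y := by
  have hfirm := hC.metricProj_firmly_nonexpansive x y
  have hsq := pow_le_pow_left₀ (norm_nonneg _) h 2
  rw [← sub_eq_zero, ← norm_eq_zero, ← sq_eq_zero_iff]
  exact le_antisymm (by linarith) (sq_nonneg _)

end IsNonemptyClosedConvex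

theorem tendsto_zero_of_tendsto_norm_sq {α E : Type*} [SeminormedAddGroup E] {l : Filter α}
    {f : α → E} (hf : Tendsto (fun i => ‖f i‖ ^ 2) l (𝓝 0)) : Tendsto f l (𝓝 0) :=
  tendsto_zero_iff_norm_tendsto_zero.2 (by simpa using hf.sqrt)

theorem tendsto_prod_Ico_one_sub {μ : ℕ → ℝ} (h01 : ∀ n, μ n ∈ Set.Icc 0 1)
    (hμ : ¬Summable μ) (m : ℕ) :
    Tendsto (fun n => ∏ i ∈ Finset.Ico m n, (1 - μ i)) atTop (𝓝 0) := by
  have hdiv : Tendsto (fun n => ∑ i ∈ Finset.range n, μ (m + i)) atTop atTop := by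
    refine (not_summable_iff_tendsto_nat_atTop_of_nonneg fun i => (h01 _).1).1 ?_
    simpa only [add_comm m, summable_nat_add_iff] using hμ
  refine squeeze_zero (fun n => Finset.prod_nonneg fun i _ => sub_nonneg.2 (h01 i).2)
    (fun n => ?_) (Real.tendsto_exp_neg_atTop_nhds_zero.comp
      (hdiv.comp (tendsto_sub_atTop_nat m)))
  calc ∏ i ∈ Finset.Ico m n, (1 - μ i)
      ≤ ∏ i ∈ Finset.Ico m n, Real.exp (-μ i) :=
        Finset.prod_le_prod (fun i _ => sub_nonneg.2 (h01 i).2) fun i _ =>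
          Real.one_sub_le_exp_neg (μ i)
    _ = Real.exp (-∑ i ∈ Finset.range (n - m), μ (m + i)) := by
        rw [← Real.exp_sum, Finset.sum_neg_distrib, Finset.sum_Ico_eq_sum_range]

theorem eventually_forall_sum_Ico_lt {e : ℕ → ℝ} (he : Summable e) {ε : ℝ} (hε : 0 < ε) :
    ∀ᶠ m in atTop, ∀ n, ∑ i ∈ Finset.Ico m n, e i < ε := by
  obtain ⟨s, hs⟩ := summable_iff_vanishing_norm.1 he ε hε
  filter_upwards [eventually_gt_atTop (s.sup id)] with m hm n
  refine (le_abs_self _).trans_lt (hs _ (Finset.disjoint_left.2 fun i hi his => ?_))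
  exact (((Finset.mem_Ico.1 hi).1.trans (Finset.le_sup (f := id) his)).trans_lt hm).false

theorem le_add_prod_mul_add_sum_of_le {s μ γ : ℕ → ℝ} {b : ℝ} {m : ℕ} (hb : 0 ≤ b)
    (h01 : ∀ n, μ n ∈ Set.Icc 0 1) (hγ : ∀ n, 0 ≤ γ n)
    (h : ∀ n ≥ m, s (n + 1) ≤ (1 - μ n) * s n + μ n * b + γ n) {n : ℕ} (hn : m ≤ n) :
    s n ≤ b + (∏ i ∈ Finset.Ico m n, (1 - μ i)) * s m + ∑ i ∈ Finset.Ico m n, γ i := by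
  induction n, hn using Nat.le_induction with
  | base => simpa using hb
  | succ n hn ih =>
    rw [Finset.prod_Ico_succ_top hn, Finset.sum_Ico_succ_top hn]
    set p := ∏ i ∈ Finset.Ico m n, (1 - μ i)
    set g := ∑ i ∈ Finset.Ico m n, γ i
    have hg : 0 ≤ μ n * g := mul_nonneg (h01 n).1 (Finset.sum_nonneg fun i _ => hγ i)
    calc s (n + 1) ≤ (1 - μ n) * s n + μ n * b + γ n := h n hn
      _ ≤ (1 - μ n) * (b + p * s m + g) + μ n * b + γ n := by
          gcongr
          exact sub_nonneg.2 (h01 n).2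
      _ ≤ b + p * (1 - μ n) * s m + (g + γ n) := by linarith

-- Xu's lemma on recursive inequalities.
theorem tendsto_zero_of_le_one_sub_mul_add {s μ β γ : ℕ → ℝ} (hs : ∀ n, 0 ≤ s n)
    (h01 : ∀ n, μ n ∈ Set.Icc 0 1) (hμ : ¬Summable μ)
    (hβ : ∀ ε > 0, ∀ᶠ n in atTop, β n ≤ ε) (hγ0 : ∀ n, 0 ≤ γ n) (hγ : Summable γ)
    (h : ∀ n, s (n + 1) ≤ (1 - μ n) * s n + μ n * β n + γ n) :
    Tendsto s atTop (𝓝 0) := by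
  refine tendsto_order.2 ⟨fun a ha => .of_forall fun n => ha.trans_le (hs n), fun ε hε => ?_⟩
  have hε3 : 0 < ε / 3 := by positivity
  obtain ⟨m, hβm, hγm⟩ := ((eventually_forall_ge_atTop.2 (hβ _ hε3)).and
    (eventually_forall_sum_Ico_lt hγ hε3)).exists
  have hprod := (tendsto_prod_Ico_one_sub h01 hμ m).mul_const (s m)
  rw [zero_mul] at hprod
  filter_upwards [hprod.eventually_lt_const hε3, eventually_ge_atTop m] with n hn hmn
  have hbound := le_add_prod_mul_add_sum_of_le (b := ε / 3) hε3.le h01 hγ0 (fun i hi => (h i).trans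
    (by gcongr; exacts [(h01 i).1, hβm i hi])) hmn
  linarith [hγm n]

/-- The conditions on the steering parameters under which HLWB with `N` sets is known to converge
(Bauschke's conditions). Only the values at `n ≥ 1` count. -/
structure IsSteeringSequence (N : ℕ) (lam : ℕ → ℝ) : Prop where
  nonneg_and_le_one : ∀ n, 1 ≤ n → 0 ≤ lam n ∧ lam n ≤ 1
  tendsto_zero : Tendsto lam atTop (𝓝 0)
  tendsto_sum : Tendsto (fun m => ∑ n ∈ Finset.Icc 1 m, lam n) atTop atTop
  summable_abs_sub : Summable fun n => |lam (n + 1) - lam (n + 1 + N)|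

namespace IsSteeringSequence

variable {N : ℕ} {lam : ℕ → ℝ}

theorem mem_Icc (hlam : IsSteeringSequence N lam) (n : ℕ) : lam (n + 1) ∈ Set.Icc 0 1 :=
  hlam.nonneg_and_le_one (n + 1) (Nat.le_add_left 1 n)

theorem not_summable (hlam : IsSteeringSequence N lam) : ¬Summable fun n => lam (n + 1) := by
  refine (not_summable_iff_tendsto_nat_atTop_of_nonneg fun n => (hlam.mem_Icc n).1).2
    (hlam.tendsto_sum.congr fun m => ?_)
  rw [Finset.range_eq_Ico, Finset.sum_Ico_add' lam, zero_add, Finset.Ico_add_one_right_eq_Icc]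

end IsSteeringSequence

/-- The factor by which the steps `m + 1, …, n` of the HLWB iteration contract the distance between
two runs with the same anchor. -/
noncomputable def contractionFactor (lam : ℕ → ℝ) (m n : ℕ) : ℝ :=
  ∏ j ∈ Finset.Ioc m n, (1 - lam j)

section ContractionFactor

variable {lam : ℕ → ℝ} {m n : ℕ}

theorem contractionFactor_self : contractionFactor lam n n = 1 := by
  simp [contractionFactor]

theorem contractionFactor_succ (hmn : m ≤ n) :
    contractionFactor lam m (n + 1) = (1 - lam (n + 1)) * contractionFactor lam m n := by
  rw [contractionFactor, Finset.prod_Ioc_succ_top hmn, mul_comm, contractionFactor]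

theorem contractionFactor_mem_Icc (h01 : ∀ n, lam (n + 1) ∈ Set.Icc 0 1) :
    contractionFactor lam m n ∈ Set.Icc 0 1 := by
  have hfactor : ∀ j ∈ Finset.Ioc m n, lam j ∈ Set.Icc 0 1 := fun j hj => by
    obtain ⟨i, rfl⟩ := Nat.exists_eq_succ_of_ne_zero (Nat.ne_zero_of_lt (Finset.mem_Ioc.1 hj).1)
    exact h01 i
  exact ⟨Finset.prod_nonneg fun j hj => sub_nonneg.2 (hfactor j hj).2,
    Finset.prod_le_one (fun j hj => sub_nonneg.2 (hfactor j hj).2)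
      fun j hj => sub_le_self _ (hfactor j hj).1⟩

theorem tendsto_contractionFactor (h01 : ∀ n, lam (n + 1) ∈ Set.Icc 0 1)
    (hlam : ¬Summable fun n => lam (n + 1)) (m : ℕ) :
    Tendsto (contractionFactor lam m) atTop (𝓝 0) := by
  refine (tendsto_prod_Ico_one_sub h01 hlam m).congr fun n => ?_
  rw [Finset.prod_Ico_add' (fun j => 1 - lam j), Finset.Ico_add_one_add_one_eq_Ioc,
    contractionFactor]

end ContractionFactor

section Hlwb

variable {E : Type*} [NormedAddCommGroup E] [InnerProductSpace ℝ E] {N : ℕ} [NeZero N]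
  {lam : ℕ → ℝ} {C : Fin N → Set E}

theorem hlwb_succ_sub (a x z : E) (n : ℕ) :
    hlwb lam C a x (n + 1) - z = lam (n + 1) • (a - z) +
      (1 - lam (n + 1)) • (metricProj (C (Fin.ofNat N n)) (hlwb lam C a x n) - z) := by
  rw [hlwb]
  module

theorem norm_convexComb_sq_le {t : ℝ} (ht : t ∈ Set.Icc 0 1) (u v : E) :
    ‖t • u + (1 - t) • v‖ ^ 2 ≤
      (1 - t) * ‖v‖ ^ 2 + t * (2 * inner ℝ u (t • u + (1 - t) • v)) := by
  have hexp := norm_add_sq_real (t • u) ((1 - t) • v)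
  rw [real_inner_smul_left, real_inner_smul_right, norm_smul_of_nonneg ht.1,
    norm_smul_of_nonneg (sub_nonneg.2 ht.2)] at hexp
  rw [inner_add_right, real_inner_smul_right, real_inner_smul_right, real_inner_self_eq_norm_sq]
  nlinarith [mul_nonneg (mul_nonneg ht.1 (sub_nonneg.2 ht.2)) (sq_nonneg ‖v‖),
    mul_nonneg (sq_nonneg t) (sq_nonneg ‖u‖)]

variable [CompleteSpace E]

theorem norm_hlwb_sub_hlwb_le (h01 : ∀ n, lam (n + 1) ∈ Set.Icc 0 1)
    (hC : ∀ i, IsNonemptyClosedConvex (C i)) (a a' x x' : E) (n : ℕ) :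
    ‖hlwb lam C a x n - hlwb lam C a' x' n‖ ≤
      (1 - contractionFactor lam 0 n) * ‖a - a'‖ + contractionFactor lam 0 n * ‖x - x'‖ := by
  induction n with
  | zero => simp [hlwb, contractionFactor_self]
  | succ n ih =>
    obtain ⟨h0, h1⟩ := h01 n
    set P := metricProj (C (Fin.ofNat N n))
    have hsplit : hlwb lam C a x (n + 1) - hlwb lam C a' x' (n + 1) =
        lam (n + 1) • (a - a') +
          (1 - lam (n + 1)) • (P (hlwb lam C a x n) - P (hlwb lam C a' x' n)) := by
      simp only [hlwb, P]
      module
    rw [hsplit, contractionFactor_succ n.zero_le]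
    calc _ ≤ lam (n + 1) * ‖a - a'‖ +
            (1 - lam (n + 1)) * ‖P (hlwb lam C a x n) - P (hlwb lam C a' x' n)‖ := by
          refine (norm_add_le _ _).trans_eq ?_
          rw [norm_smul_of_nonneg h0, norm_smul_of_nonneg (sub_nonneg.2 h1)]
      _ ≤ lam (n + 1) * ‖a - a'‖ + (1 - lam (n + 1)) *
            ((1 - contractionFactor lam 0 n) * ‖a - a'‖ +
              contractionFactor lam 0 n * ‖x - x'‖) := by
          have := sub_nonneg.2 h1
          gcongr
          exact ((hC _).norm_metricProj_sub_metricProj_le _ _).trans ih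
      _ = _ := by ring

theorem lipschitzWith_hlwb_anchor (h01 : ∀ n, lam (n + 1) ∈ Set.Icc 0 1)
    (hC : ∀ i, IsNonemptyClosedConvex (C i)) (x : E) (n : ℕ) :
    LipschitzWith 1 fun a => hlwb lam C a x n :=
  LipschitzWith.mk_one fun a a' => by
    rw [dist_eq_norm, dist_eq_norm]
    refine (norm_hlwb_sub_hlwb_le h01 hC a a' x x n).trans ?_
    rw [sub_self, norm_zero, mul_zero, add_zero]
    exact mul_le_of_le_one_left (norm_nonneg _) (sub_le_self _ (contractionFactor_mem_Icc h01).1)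

theorem hlwb_eq_self (hC : ∀ i, IsNonemptyClosedConvex (C i)) {z : E} (hz : z ∈ ⋂ i, C i)
    (n : ℕ) : hlwb lam C z z n = z := by
  induction n with
  | zero => rfl
  | succ n ih =>
    rw [hlwb, ih, (hC _).metricProj_eq_self (Set.mem_iInter.1 hz _), ← add_smul,
      add_sub_cancel, one_smul]

theorem norm_hlwb_sub_le_max (h01 : ∀ n, lam (n + 1) ∈ Set.Icc 0 1)
    (hC : ∀ i, IsNonemptyClosedConvex (C i)) (a x : E) {z : E} (hz : z ∈ ⋂ i, C i) (n : ℕ) :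
    ‖hlwb lam C a x n - z‖ ≤ max ‖a - z‖ ‖x - z‖ := by
  have hfactor := contractionFactor_mem_Icc (m := 0) (n := n) h01
  have hbound := norm_hlwb_sub_hlwb_le h01 hC a z x z n
  rw [hlwb_eq_self hC hz] at hbound
  exact hbound.trans
    (Convex.combo_le_max _ _ (sub_nonneg.2 hfactor.2) hfactor.1 (sub_add_cancel _ _))

theorem norm_hlwb_sub_metricProj_sq_le (h01 : ∀ n, lam (n + 1) ∈ Set.Icc 0 1)
    (hC : ∀ i, IsNonemptyClosedConvex (C i)) (a x : E) {z : E} (hz : z ∈ ⋂ i, C i) (n : ℕ) :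
    ‖hlwb lam C a x n - metricProj (C (Fin.ofNat N n)) (hlwb lam C a x n)‖ ^ 2 ≤
      ‖hlwb lam C a x n - z‖ ^ 2 - ‖hlwb lam C a x (n + 1) - z‖ ^ 2 +
        lam (n + 1) * ‖a - z‖ ^ 2 := by
  obtain ⟨h0, h1⟩ := h01 n
  have hzn := Set.mem_iInter.1 hz (Fin.ofNat N n)
  have hfirm := (hC (Fin.ofNat N n)).metricProj_firmly_nonexpansive (hlwb lam C a x n) z
  rw [(hC _).metricProj_eq_self hzn, sub_self, sub_zero] at hfirm
  have hconv := (convexOn_univ_norm.pow (fun _ _ => norm_nonneg _) 2).2 (Set.mem_univ (a - z))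
    (Set.mem_univ (metricProj (C (Fin.ofNat N n)) (hlwb lam C a x n) - z)) h0 (sub_nonneg.2 h1)
    (add_sub_cancel _ _)
  rw [← hlwb_succ_sub] at hconv
  simp only [Pi.pow_apply, smul_eq_mul] at hconv
  nlinarith [sq_nonneg ‖metricProj (C (Fin.ofNat N n)) (hlwb lam C a x n) - z‖]

theorem exists_lt_ofNat_add_eq (n : ℕ) (i : Fin N) : ∃ j < N, Fin.ofNat N (n + j) = i := by
  refine ⟨(i - Fin.ofNat N n).val, Fin.isLt _, ?_⟩
  rw [← Fin.ofNat_add, add_sub_cancel]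

theorem norm_anchor_sub_metricProj_hlwb_le (h01 : ∀ n, lam (n + 1) ∈ Set.Icc 0 1)
    (hC : ∀ i, IsNonemptyClosedConvex (C i)) (a x : E) {z : E} (hz : z ∈ ⋂ i, C i) (n : ℕ)
    (i : Fin N) :
    ‖a - metricProj (C i) (hlwb lam C a x n)‖ ≤ ‖a - z‖ + max ‖a - z‖ ‖x - z‖ := by
  refine (norm_sub_le_norm_sub_add_norm_sub a z _).trans (add_le_add_right ?_ _)
  rw [norm_sub_rev]
  exact ((hC i).norm_metricProj_sub_le _ (Set.mem_iInter.1 hz i)).trans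
    (norm_hlwb_sub_le_max h01 hC a x hz n)

theorem norm_hlwb_add_succ_sub_le (h01 : ∀ n, lam (n + 1) ∈ Set.Icc 0 1)
    (hC : ∀ i, IsNonemptyClosedConvex (C i)) (a x : E) {z : E} (hz : z ∈ ⋂ i, C i) (n : ℕ) :
    ‖hlwb lam C a x (n + 1 + N) - hlwb lam C a x (n + 1)‖ ≤
      (1 - lam (n + 1 + N)) * ‖hlwb lam C a x (n + N) - hlwb lam C a x n‖ +
        |lam (n + 1) - lam (n + 1 + N)| * (‖a - z‖ + max ‖a - z‖ ‖x - z‖) := by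
  set q := hlwb lam C a x with hq
  set i := Fin.ofNat N n with hi
  have h1 : 0 ≤ 1 - lam (n + 1 + N) := by
    rw [add_right_comm]
    exact sub_nonneg.2 (h01 (n + N)).2
  have hperiod : Fin.ofNat N (n + N) = i := by
    ext
    simp [hi]
  have hsplit : q (n + 1 + N) - q (n + 1) =
      (1 - lam (n + 1 + N)) • (metricProj (C i) (q (n + N)) - metricProj (C i) (q n)) -
        (lam (n + 1) - lam (n + 1 + N)) • (a - metricProj (C i) (q n)) := by
    rw [add_right_comm n 1 N, hq, hlwb, hlwb, hperiod]
    module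
  rw [hsplit]
  refine (norm_sub_le _ _).trans ?_
  rw [norm_smul_of_nonneg h1, norm_smul, Real.norm_eq_abs]
  gcongr
  · exact (hC i).norm_metricProj_sub_metricProj_le _ _
  · exact norm_anchor_sub_metricProj_hlwb_le h01 hC a x hz n i

theorem tendsto_hlwb_add_period_sub_hlwb (hlam : IsSteeringSequence N lam)
    (hC : ∀ i, IsNonemptyClosedConvex (C i)) (hne : (⋂ i, C i).Nonempty) (a x : E) :
    Tendsto (fun n => hlwb lam C a x (n + N) - hlwb lam C a x n) atTop (𝓝 0) := by
  obtain ⟨z, hz⟩ := hne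
  have hshift : ∀ n, lam (n + 1 + N) = lam (n + N + 1) := fun n => by rw [add_right_comm]
  refine tendsto_zero_iff_norm_tendsto_zero.2 <| tendsto_zero_of_le_one_sub_mul_add
    (μ := fun n => lam (n + 1 + N)) (β := 0)
    (γ := fun n => |lam (n + 1) - lam (n + 1 + N)| * (‖a - z‖ + max ‖a - z‖ ‖x - z‖))
    (fun _ => norm_nonneg _) (fun n => hshift n ▸ hlam.mem_Icc (n + N)) ?_
    (fun ε hε => .of_forall fun _ => hε.le) (fun _ => by positivity)
    (hlam.summable_abs_sub.mul_right _) fun n => ?_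
  · simp only [hshift]
    exact (summable_nat_add_iff N).not.2 hlam.not_summable
  · simpa using norm_hlwb_add_succ_sub_le hlam.mem_Icc hC a x hz n

theorem norm_hlwb_sub_metricProj_sq_le_period (h01 : ∀ n, lam (n + 1) ∈ Set.Icc 0 1)
    (hC : ∀ i, IsNonemptyClosedConvex (C i)) (a x : E) {z : E} (hz : z ∈ ⋂ i, C i) (n : ℕ) :
    ‖hlwb lam C a x n - metricProj (C (Fin.ofNat N n)) (hlwb lam C a x n)‖ ^ 2 ≤
      2 * max ‖a - z‖ ‖x - z‖ * ‖hlwb lam C a x (n + N) - hlwb lam C a x n‖ +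
        (∑ j ∈ Finset.range N, lam (n + j + 1)) * ‖a - z‖ ^ 2 := by
  have hbdd := norm_hlwb_sub_le_max h01 hC a x hz
  have hstep := norm_hlwb_sub_metricProj_sq_le h01 hC a x hz
  set q := hlwb lam C a x
  set r := max ‖a - z‖ ‖x - z‖
  have hdrop : ‖q n - z‖ ^ 2 - ‖q (n + N) - z‖ ^ 2 ≤ 2 * r * ‖q (n + N) - q n‖ := by
    have htri : ‖q n - z‖ - ‖q (n + N) - z‖ ≤ ‖q (n + N) - q n‖ := by
      rw [norm_sub_rev (q (n + N)) (q n)]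
      exact (norm_sub_norm_le _ _).trans_eq (by rw [sub_sub_sub_cancel_right])
    calc ‖q n - z‖ ^ 2 - ‖q (n + N) - z‖ ^ 2
        = (‖q n - z‖ + ‖q (n + N) - z‖) * (‖q n - z‖ - ‖q (n + N) - z‖) := sq_sub_sq _ _
      _ ≤ (r + r) * ‖q (n + N) - q n‖ :=
          (mul_le_mul_of_nonneg_left htri (by positivity)).trans
            (mul_le_mul_of_nonneg_right (add_le_add (hbdd n) (hbdd _)) (norm_nonneg _))
      _ = 2 * r * ‖q (n + N) - q n‖ := by ring
  calc ‖q n - metricProj (C (Fin.ofNat N n)) (q n)‖ ^ 2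
      ≤ ∑ j ∈ Finset.range N,
          ‖q (n + j) - metricProj (C (Fin.ofNat N (n + j))) (q (n + j))‖ ^ 2 :=
        Finset.single_le_sum (f := fun j =>
          ‖q (n + j) - metricProj (C (Fin.ofNat N (n + j))) (q (n + j))‖ ^ 2)
          (fun j _ => sq_nonneg _) (Finset.mem_range.2 (NeZero.pos N))
    _ ≤ ∑ j ∈ Finset.range N, (‖q (n + j) - z‖ ^ 2 - ‖q (n + (j + 1)) - z‖ ^ 2 +
          lam (n + j + 1) * ‖a - z‖ ^ 2) := Finset.sum_le_sum fun j _ => hstep (n + j)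
    _ = ‖q n - z‖ ^ 2 - ‖q (n + N) - z‖ ^ 2 +
          (∑ j ∈ Finset.range N, lam (n + j + 1)) * ‖a - z‖ ^ 2 := by
        rw [Finset.sum_add_distrib, Finset.sum_range_sub' fun j => ‖q (n + j) - z‖ ^ 2,
          Finset.sum_mul, add_zero]
    _ ≤ _ := add_le_add_left hdrop _

theorem tendsto_hlwb_sub_metricProj_next (hlam : IsSteeringSequence N lam)
    (hC : ∀ i, IsNonemptyClosedConvex (C i)) (hne : (⋂ i, C i).Nonempty) (a x : E) :
    Tendsto (fun n => hlwb lam C a x n -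
      metricProj (C (Fin.ofNat N n)) (hlwb lam C a x n)) atTop (𝓝 0) := by
  have ⟨z, hz⟩ := hne
  have hlam0 : Tendsto (fun n => ∑ j ∈ Finset.range N, lam (n + j + 1)) atTop (𝓝 0) := by
    simpa [Function.comp_def, add_assoc] using tendsto_finsetSum (Finset.range N)
      fun j _ => hlam.tendsto_zero.comp (tendsto_add_atTop_nat (j + 1))
  have hperiod := (tendsto_hlwb_add_period_sub_hlwb hlam hC hne a x).norm
  rw [norm_zero] at hperiod
  have hbound := (hperiod.const_mul (2 * max ‖a - z‖ ‖x - z‖)).add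
    (hlam0.mul_const (‖a - z‖ ^ 2))
  rw [mul_zero, zero_mul, add_zero] at hbound
  have hsq := squeeze_zero (fun n => sq_nonneg _)
    (norm_hlwb_sub_metricProj_sq_le_period hlam.mem_Icc hC a x hz) hbound
  exact tendsto_zero_of_tendsto_norm_sq hsq

theorem tendsto_hlwb_add_sub_hlwb (hlam : IsSteeringSequence N lam)
    (hC : ∀ i, IsNonemptyClosedConvex (C i)) (hne : (⋂ i, C i).Nonempty) (a x : E) (j : ℕ) :
    Tendsto (fun n => hlwb lam C a x (n + j) - hlwb lam C a x n) atTop (𝓝 0) := by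
  have ⟨z, hz⟩ := hne
  set q := hlwb lam C a x with hq
  have hstep : Tendsto (fun n => q (n + 1) - q n) atTop (𝓝 0) := by
    have hlam0 := (tendsto_add_atTop_iff_nat 1).2 hlam.tendsto_zero
    have hdist : Tendsto (fun n => lam (n + 1) • (a - metricProj (C (Fin.ofNat N n)) (q n)))
        atTop (𝓝 0) := by
      refine hlam0.zero_smul_isBoundedUnder_le
        (isBoundedUnder_of ⟨‖a - z‖ + max ‖a - z‖ ‖x - z‖, fun n =>
          norm_anchor_sub_metricProj_hlwb_le hlam.mem_Icc hC a x hz n _⟩)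
    have h := hdist.sub (tendsto_hlwb_sub_metricProj_next hlam hC hne a x)
    rw [sub_zero] at h
    refine h.congr fun n => ?_
    rw [hq, hlwb]
    module
  induction j with
  | zero => simp
  | succ j ih =>
    have h := ((tendsto_add_atTop_iff_nat j).2 hstep).add ih
    rw [add_zero] at h
    exact h.congr fun n => sub_add_sub_cancel _ _ _

theorem tendsto_hlwb_sub_metricProj (hlam : IsSteeringSequence N lam)
    (hC : ∀ i, IsNonemptyClosedConvex (C i)) (hne : (⋂ i, C i).Nonempty) (a x : E) (i : Fin N) :
    Tendsto (fun n => hlwb lam C a x n - metricProj (C i) (hlwb lam C a x n)) atTop (𝓝 0) := by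
  set q := hlwb lam C a x
  have hdelay : ∀ j, Tendsto
      (fun n => 2 * ‖q (n + j) - q n‖ +
        ‖q (n + j) - metricProj (C (Fin.ofNat N (n + j))) (q (n + j))‖) atTop (𝓝 0) := fun j => by
    simpa using ((tendsto_hlwb_add_sub_hlwb hlam hC hne a x j).norm.const_mul 2).add
      ((tendsto_add_atTop_iff_nat j).2 (tendsto_hlwb_sub_metricProj_next hlam hC hne a x)).norm
  refine NormedAddGroup.tendsto_nhds_zero.2 fun ε hε => ?_
  have hev : ∀ᶠ n in atTop, ∀ j ∈ Finset.range N, _ :=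
    (Finset.range N).eventually_all.2 fun j _ => (hdelay j).eventually_lt_const hε
  filter_upwards [hev] with n hn
  obtain ⟨j, hj, rfl⟩ := exists_lt_ofNat_add_eq n i
  have hlt := hn j (Finset.mem_range.2 hj)
  set P := metricProj (C (Fin.ofNat N (n + j)))
  have hP : ‖P (q (n + j)) - P (q n)‖ ≤ ‖q (n + j) - q n‖ :=
    (hC _).norm_metricProj_sub_metricProj_le _ _
  have htri : ‖q n - P (q n)‖ ≤ ‖q n - q (n + j)‖ + ‖q (n + j) - P (q (n + j))‖ +
      ‖P (q (n + j)) - P (q n)‖ := by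
    refine le_trans (le_of_eq ?_) norm_add₃_le
    congr 1
    abel
  rw [norm_sub_rev (q n) (q (n + j))] at htri
  linarith

theorem mem_iInter_of_mapClusterPt_hlwb (hlam : IsSteeringSequence N lam)
    (hC : ∀ i, IsNonemptyClosedConvex (C i)) (hne : (⋂ i, C i).Nonempty) {a x y : E}
    (hy : MapClusterPt y atTop (hlwb lam C a x)) : y ∈ ⋂ i, C i := by
  refine Set.mem_iInter.2 fun i => ?_
  obtain ⟨φ, hφ, hlim⟩ := hy.tendsto_subseq
  have hP := ((hC i).lipschitzWith_metricProj.continuous.tendsto y).comp hlim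
  have h0 := (tendsto_hlwb_sub_metricProj hlam hC hne a x i).comp hφ.tendsto_atTop
  have hfix : y = metricProj (C i) y :=
    sub_eq_zero.1 (tendsto_nhds_unique (hlim.sub hP) h0)
  exact hfix ▸ (hC i).metricProj_mem y

theorem eventually_inner_hlwb_sub_le [ProperSpace E] (hlam : IsSteeringSequence N lam)
    (hC : ∀ i, IsNonemptyClosedConvex (C i)) (hne : (⋂ i, C i).Nonempty) (a x : E) {ε : ℝ}
    (hε : 0 < ε) :
    ∀ᶠ n in atTop, inner ℝ (a - metricProj (⋂ i, C i) a)
      (hlwb lam C a x n - metricProj (⋂ i, C i) a) ≤ ε := by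
  have hI := IsNonemptyClosedConvex.iInter hC hne
  set z := metricProj (⋂ i, C i) a
  have hbdd := norm_hlwb_sub_le_max hlam.mem_Icc hC a x (hI.metricProj_mem a)
  by_contra hcon
  set K := Metric.closedBall z (max ‖a - z‖ ‖x - z‖) ∩ {y | ε ≤ inner ℝ (a - z) (y - z)}
  have hK : IsCompact K :=
    (isCompact_closedBall z _).inter_right (isClosed_le continuous_const (by fun_prop))
  have hfreq : ∃ᶠ n in atTop, hlwb lam C a x n ∈ K :=
    (not_eventually.1 hcon).mono fun n hn => ⟨mem_closedBall_iff_norm.2 (hbdd n), (not_le.1 hn).le⟩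
  obtain ⟨y, hyK, hy⟩ := hK.exists_mapClusterPt_of_frequently hfreq
  exact (hε.trans_le hyK.2).not_ge (hI.inner_sub_metricProj_le_zero a
    (mem_iInter_of_mapClusterPt_hlwb hlam hC hne hy))

-- Bauschke's theorem for cyclic projections, extending work of Halpern, Lions and Wittmann.
theorem tendsto_hlwb [ProperSpace E] (hlam : IsSteeringSequence N lam)
    (hC : ∀ i, IsNonemptyClosedConvex (C i)) (hne : (⋂ i, C i).Nonempty) (a x : E) :
    Tendsto (hlwb lam C a x) atTop (𝓝 (metricProj (⋂ i, C i) a)) := by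
  have hinner := fun ε => eventually_inner_hlwb_sub_le hlam hC hne a x (ε := ε)
  have hz := Set.mem_iInter.1 ((IsNonemptyClosedConvex.iInter hC hne).metricProj_mem a)
  set z := metricProj (⋂ i, C i) a
  have hsq : Tendsto (fun n => ‖hlwb lam C a x n - z‖ ^ 2) atTop (𝓝 0) := by
    refine tendsto_zero_of_le_one_sub_mul_add (μ := fun n => lam (n + 1))
      (β := fun n => 2 * inner ℝ (a - z) (hlwb lam C a x (n + 1) - z)) (γ := 0)
      (fun n => sq_nonneg _) hlam.mem_Icc hlam.not_summable (fun ε hε => ?_) (fun _ => le_rfl)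
      summable_zero fun n => ?_
    · filter_upwards [(tendsto_add_atTop_nat 1).eventually (hinner (ε / 2) (half_pos hε))] with n hn
      linarith
    · have hcomb := norm_convexComb_sq_le (hlam.mem_Icc n) (a - z)
        (metricProj (C (Fin.ofNat N n)) (hlwb lam C a x n) - z)
      rw [← hlwb_succ_sub] at hcomb
      refine hcomb.trans ?_
      simp only [Pi.zero_apply, add_zero]
      gcongr
      · exact sub_nonneg.2 (hlam.mem_Icc n).2
      · exact (hC _).norm_metricProj_sub_le _ (hz _)
  exact tendsto_sub_nhds_zero_iff.1 (tendsto_zero_of_tendsto_norm_sq hsq)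

end Hlwb

section NonexpansiveLimit

variable {α β ι : Type*} [PseudoMetricSpace α] [PseudoMetricSpace β] {l : Filter ι}
  {f : ι → α → β}

theorem tendsto_uncurry_of_lipschitzWith (hf : ∀ i, LipschitzWith 1 (f i)) {x : α} {y : β}
    (h : Tendsto (fun i => f i x) l (𝓝 y)) :
    Tendsto (fun q : ι × α => f q.1 q.2) (l ×ˢ 𝓝 x) (𝓝 y) := by
  have hdist : Tendsto (fun q : ι × α => dist q.2 x + dist (f q.1 x) y) (l ×ˢ 𝓝 x) (𝓝 0) := by
    simpa using (tendsto_iff_dist_tendsto_zero.1 tendsto_snd).add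
      (tendsto_iff_dist_tendsto_zero.1 (h.comp tendsto_fst))
  refine tendsto_iff_dist_tendsto_zero.2 (squeeze_zero (fun _ => dist_nonneg) (fun q => ?_) hdist)
  refine (dist_triangle _ (f q.1 x) _).trans (add_le_add_left ?_ _)
  simpa using (hf q.1).dist_le_mul q.2 x

theorem tendsto_apply_of_lipschitzWith (hf : ∀ i, LipschitzWith 1 (f i)) {u : ι → α} {x : α}
    {y : β} (h : Tendsto (fun i => f i x) l (𝓝 y)) (hu : Tendsto u l (𝓝 x)) :
    Tendsto (fun i => f i (u i)) l (𝓝 y) :=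
  (tendsto_uncurry_of_lipschitzWith hf h).comp (tendsto_id.prodMk hu)

theorem lipschitzWith_of_tendsto [l.NeBot] (hf : ∀ i, LipschitzWith 1 (f i)) {g : α → β}
    (h : ∀ x, Tendsto (fun i => f i x) l (𝓝 (g x))) : LipschitzWith 1 g :=
  IsClosed.mem_of_tendsto (isClosed_setOfPred_lipschitzWith 1) (tendsto_pi_nhds.2 h) (.of_forall hf)

theorem eventually_forall_mem_of_lipschitzWith (hf : ∀ i, LipschitzWith 1 (f i)) {g : α → β}
    {K : Set α} {U : Set β} (h : ∀ x ∈ K, Tendsto (fun i => f i x) l (𝓝 (g x)))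
    (hK : IsCompact K) (hU : IsOpen U) (hgU : ∀ x ∈ K, g x ∈ U) :
    ∀ᶠ i in l, ∀ x ∈ K, f i x ∈ U := by
  have hprod : ∀ᶠ q in l ×ˢ 𝓝ˢ K, f q.1 q.2 ∈ U := hK.mem_prod_nhdsSet_of_forall fun x hx =>
    (tendsto_uncurry_of_lipschitzWith hf (h x hx)).eventually (hU.mem_nhds (hgU x hx))
  exact hprod.curry.mono fun _ hi => hi.self_of_nhdsSet

end NonexpansiveLimit

section ClusterSet

variable {X : Type*} [PseudoMetricSpace X] {z : ℕ → X}

theorem tendsto_infDist_clusterSet [ProperSpace X] (hz : Bornology.IsBounded (Set.range z)) :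
    Tendsto (fun k => Metric.infDist (z k) {y | MapClusterPt y atTop z}) atTop (𝓝 0) := by
  refine tendsto_order.2 ⟨fun a ha => .of_forall fun k => ha.trans_le Metric.infDist_nonneg,
    fun ε hε => ?_⟩
  by_contra hfreq
  have hK : IsCompact (closure (Set.range z) ∩
      {x | ε ≤ Metric.infDist x {y | MapClusterPt y atTop z}}) :=
    hz.isCompact_closure.inter_right
      (isClosed_le continuous_const (Metric.continuous_infDist_pt _))
  obtain ⟨y, ⟨-, hyε⟩, hy⟩ := hK.exists_mapClusterPt_of_frequently
    ((not_eventually.1 hfreq).mono fun k hk =>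
      ⟨subset_closure (Set.mem_range_self k), not_lt.1 hk⟩)
  exact (hε.trans_le hyε).ne' (Metric.infDist_zero_of_mem hy)

theorem isCompact_clusterSet [ProperSpace X] (hz : Bornology.IsBounded (Set.range z)) :
    IsCompact {y | MapClusterPt y atTop z} :=
  hz.isCompact_closure.of_isClosed_subset isClosed_setOfPred_clusterPt fun _ hy =>
    isClosed_closure.mem_of_mapClusterPt hy
      (.of_forall fun k => subset_closure (Set.mem_range_self k))

theorem exists_mapClusterPt_of_isBounded_range [ProperSpace X]
    (hz : Bornology.IsBounded (Set.range z)) : ∃ y, MapClusterPt y atTop z :=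
  (hz.isCompact_closure.exists_mapClusterPt_of_frequently
    (Frequently.of_forall fun k => subset_closure (Set.mem_range_self k))).imp fun _ h => h.2

end ClusterSet

/-- A map all of whose non-fixed points are moved strictly closer to each of its fixed points. -/
def IsParacontracting {X : Type*} [PseudoMetricSpace X] (T : X → X) : Prop :=
  ∀ p ∈ Function.fixedPoints T, ∀ x ∉ Function.fixedPoints T, dist (T x) p < dist x p

theorem IsParacontracting.infDist_fixedPoints_lt {X : Type*} [MetricSpace X] [ProperSpace X]
    {T : X → X} (hT : IsParacontracting T) (hcont : Continuous T)
    (hfix : (Function.fixedPoints T).Nonempty) {x : X} (hx : x ∉ Function.fixedPoints T) :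
    Metric.infDist (T x) (Function.fixedPoints T) < Metric.infDist x (Function.fixedPoints T) := by
  obtain ⟨p, hp, hxp⟩ := (isClosed_fixedPoints hcont).exists_infDist_eq_dist hfix x
  exact (Metric.infDist_le_dist_of_mem hp).trans_lt (hxp ▸ hT p hp x hx)

section Orbit

theorem exists_orbit_from {X : Type*} (R : ℕ → X → X) (m : ℕ) (p : X) :
    ∃ z : ℕ → X, z m = p ∧ ∀ k ≥ m, z (k + 1) = R k (z k) := by
  refine ⟨fun k => Nat.rec p (fun j x => if j < m then p else R j x) k, ?_, fun k hk => ?_⟩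
  · cases m with
    | zero => rfl
    | succ m => simp only [Nat.lt_succ_self, if_true]
  · simp only [not_lt.2 hk, if_false]

variable {X : Type*} [MetricSpace X] {R : ℕ → X → X} {T : X → X} {z : ℕ → X}

theorem isBounded_range_of_isBounded_orbit (hR : ∀ k, LipschitzWith 1 (R k))
    (hz : ∀ k, z (k + 1) = R k (z k)) {w : ℕ → X} {m : ℕ} {p : X} {r : ℝ}
    (hw : ∀ k ≥ m, w (k + 1) = R k (w k)) (hwr : ∀ k ≥ m, dist (w k) p ≤ r) :
    Bornology.IsBounded (Set.range z) := by
  have hclose : ∀ k ≥ m, dist (z k) (w k) ≤ dist (z m) (w m) := fun k hk => by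
    induction k, hk using Nat.le_induction with
    | base => rfl
    | succ k hk ih =>
      rw [hz, hw k hk]
      exact ((hR k).dist_le_mul _ _).trans (by simpa using ih)
  have htail : Bornology.IsBounded (z '' Set.Ici m) := by
    refine Metric.isBounded_closedBall (x := p) (r := dist (z m) (w m) + r) |>.subset ?_
    rintro _ ⟨k, hk, rfl⟩
    exact (dist_triangle _ (w k) _).trans (add_le_add (hclose k hk) (hwr k hk))
  refine (((Set.finite_Iio m).image z).isBounded.union htail).subset ?_
  rw [← Set.image_union, Set.Iio_union_Ici, Set.image_univ]

theorem tendsto_orbit_add_one (hR : ∀ k, LipschitzWith 1 (R k))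
    (hRT : ∀ x, Tendsto (fun k => R k x) atTop (𝓝 (T x))) (hz : ∀ k, z (k + 1) = R k (z k))
    {φ : ℕ → ℕ} (hφ : Tendsto φ atTop atTop) {y : X} (hy : Tendsto (z ∘ φ) atTop (𝓝 y)) :
    Tendsto (fun j => z (φ j + 1)) atTop (𝓝 (T y)) := by
  simp only [hz]
  exact tendsto_apply_of_lipschitzWith (fun j => hR (φ j)) ((hRT y).comp hφ) hy

theorem exists_mapClusterPt_apply_eq [ProperSpace X] (hR : ∀ k, LipschitzWith 1 (R k))
    (hRT : ∀ x, Tendsto (fun k => R k x) atTop (𝓝 (T x))) (hz : ∀ k, z (k + 1) = R k (z k))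
    (hbdd : Bornology.IsBounded (Set.range z)) {y : X} (hy : MapClusterPt y atTop z) :
    ∃ x, MapClusterPt x atTop z ∧ T x = y := by
  obtain ⟨φ, hφ, hlim⟩ := ((mapClusterPt_comp (u := z) (φ := fun k => k + 1)).2
    (by rwa [map_add_atTop_eq_nat])).tendsto_subseq
  obtain ⟨x, -, ψ, hψ, hx⟩ := tendsto_subseq_of_bounded hbdd
    fun j => Set.mem_range_self (f := z) (φ j)
  have hφψ := hφ.tendsto_atTop.comp hψ.tendsto_atTop
  exact ⟨x, hx.mapClusterPt.of_comp hφψ, tendsto_nhds_unique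
    (tendsto_orbit_add_one hR hRT hz hφψ hx) (hlim.comp hψ.tendsto_atTop)⟩

theorem isFixedPt_of_mapClusterPt [ProperSpace X] (hR : ∀ k, LipschitzWith 1 (R k))
    (hRT : ∀ x, Tendsto (fun k => R k x) atTop (𝓝 (T x))) (hT : IsParacontracting T)
    (hfix : (Function.fixedPoints T).Nonempty) (hz : ∀ k, z (k + 1) = R k (z k))
    (hbdd : Bornology.IsBounded (Set.range z)) {y : X} (hy : MapClusterPt y atTop z) :
    Function.IsFixedPt T y := by
  have hcont := (lipschitzWith_of_tendsto hR hRT).continuous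
  obtain ⟨x, hx, hmax⟩ := (isCompact_clusterSet hbdd).exists_isMaxOn ⟨y, hy⟩
    (Metric.continuous_infDist_pt (Function.fixedPoints T)).continuousOn
  obtain ⟨x', hx', rfl⟩ := exists_mapClusterPt_apply_eq hR hRT hz hbdd hx
  have hx'fix : Function.IsFixedPt T x' := by
    by_contra hnot
    exact (hT.infDist_fixedPoints_lt hcont hfix hnot).not_ge (hmax hx')
  refine ((isClosed_fixedPoints hcont).mem_iff_infDist_zero hfix).2
    (le_antisymm ((hmax hy).trans_eq ?_) Metric.infDist_nonneg)
  rw [hx'fix]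
  exact Metric.infDist_zero_of_mem hx'fix

end Orbit

theorem eventually_forall_norm_sub_le {X : Type*} [SeminormedAddCommGroup X] {p : X}
    {P : X → Prop} (h : ∀ᶠ x in 𝓝 p, P x) (c : ℝ) :
    ∀ᶠ ε in 𝓝[>] 0, ∀ x, ‖x - p‖ ≤ c * ε → P x := by
  have hc : Tendsto (fun ε : ℝ => c * ε) (𝓝[>] 0) (𝓝 0) :=
    ((continuous_const_mul c).tendsto' 0 0 (mul_zero c)).mono_left nhdsWithin_le_nhds
  filter_upwards [hc.eventually (eventually_closedBall_subset h)] with ε hε x hx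
  exact hε (mem_closedBall_iff_norm.2 hx)

/-- Near `p`, the maps `R k` move points by a summable amount in the directions of `K`, uniformly
in the point. -/
def HasSummableDrift {X : Type*} [NormedAddCommGroup X] [InnerProductSpace ℝ X] (R : ℕ → X → X)
    (K : Submodule ℝ X) [K.HasOrthogonalProjection] (p : X) : Prop :=
  ∃ e : ℕ → ℝ, Summable e ∧
    ∀ᶠ q in atTop ×ˢ 𝓝 p, ‖K.starProjection (R q.1 q.2 - q.2)‖ ≤ e q.1

section Drift

variable {X : Type*} [NormedAddCommGroup X] [InnerProductSpace ℝ X] {R : ℕ → X → X}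
  {K : Submodule ℝ X} [K.HasOrthogonalProjection] {p : X}

theorem HasSummableDrift.comp {Q : ℕ → X → X} {q : X} (hR : HasSummableDrift R K p)
    (hQ : HasSummableDrift Q K q) (hlip : ∀ k, LipschitzWith 1 (R k))
    (hpq : Tendsto (fun k => R k p) atTop (𝓝 q)) :
    HasSummableDrift (fun k => Q k ∘ R k) K p := by
  obtain ⟨e, he, hRe⟩ := hR
  obtain ⟨f, hf, hQf⟩ := hQ
  refine ⟨f + e, hf.add he, ?_⟩
  filter_upwards [hRe, (tendsto_fst.prodMk (tendsto_uncurry_of_lipschitzWith hlip hpq)).eventually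
    hQf] with ⟨k, x⟩ hx hy
  rw [← sub_add_sub_cancel _ (R k x) x, map_add]
  exact (norm_add_le _ _).trans (add_le_add hy hx)

theorem norm_sub_le_of_starProjection {y q : X} {ε s : ℝ} (hq : q - p ∈ K) (hyq : ‖y - q‖ ≤ ε)
    (hy : ‖K.starProjection (y - p)‖ ≤ s) : ‖y - p‖ ≤ s + 2 * ε := by
  have hsplit : y - p = K.starProjection (y - p) + (y - q) - K.starProjection (y - q) := by
    rw [← sub_add_sub_cancel y q p, map_add, Submodule.starProjection_eq_self_iff.2 hq]
    abel
  rw [hsplit]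
  refine (norm_sub_le _ _).trans ?_
  linarith [norm_add_le (K.starProjection (y - p)) (y - q), K.norm_starProjection_apply_le (y - q)]

-- The distance to `S` controls the component of `z k - p` normal to `K`, the drift the tangential
-- one.
theorem norm_sub_le_of_sum_drift_le [ProperSpace X] {S : Set X} (hS : IsClosed S)
    (hSne : S.Nonempty) {z : ℕ → X} {e : ℕ → ℝ} {ε : ℝ} {m : ℕ} (hε : 0 ≤ ε)
    (hSK : ∀ q ∈ S, ‖q - p‖ ≤ 6 * ε → q - p ∈ K) (hm : ‖z m - p‖ ≤ ε)
    (hSm : Metric.infDist (z m) S ≤ ε) (hsum : ∀ n, ∑ i ∈ Finset.Ico m n, e i ≤ ε)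
    (hstep : ∀ k ≥ m, ‖z k - p‖ ≤ 4 * ε → Metric.infDist (z k) S ≤ ε →
      ‖z (k + 1) - p‖ ≤ ‖z k - p‖ + ε ∧ Metric.infDist (z (k + 1)) S ≤ ε ∧
        ‖K.starProjection (z (k + 1) - z k)‖ ≤ e k) {k : ℕ} (hk : m ≤ k) :
    ‖z k - p‖ ≤ 4 * ε ∧ Metric.infDist (z k) S ≤ ε ∧
      ‖K.starProjection (z k - p)‖ ≤ ε + ∑ i ∈ Finset.Ico m k, e i := by
  induction k, hk using Nat.le_induction with
  | base => exact ⟨by linarith, hSm, by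
      simpa using (K.norm_starProjection_apply_le _).trans hm⟩
  | succ k hk ih =>
    obtain ⟨hzk, hSk, htan⟩ := ih
    obtain ⟨hz, hSk', hdrift⟩ := hstep k hk hzk hSk
    have htan' : ‖K.starProjection (z (k + 1) - p)‖ ≤ ε + ∑ i ∈ Finset.Ico m (k + 1), e i := by
      rw [Finset.sum_Ico_succ_top hk, ← sub_add_sub_cancel _ (z k) p, map_add]
      linarith [norm_add_le (K.starProjection (z (k + 1) - z k)) (K.starProjection (z k - p))]
    obtain ⟨q, hq, hzq⟩ := hS.exists_infDist_eq_dist hSne (z (k + 1))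
    rw [hzq, dist_eq_norm] at hSk'
    have hqp : ‖q - p‖ ≤ 6 * ε := by
      linarith [norm_sub_le_norm_sub_add_norm_sub q (z (k + 1)) p, norm_sub_rev q (z (k + 1))]
    have hz' := norm_sub_le_of_starProjection (hSK q hq hqp) hSk' htan'
    exact ⟨by linarith [hsum (k + 1)], by rwa [hzq, dist_eq_norm], htan'⟩

theorem HasSummableDrift.eventually_confined [ProperSpace X] (hdrift : HasSummableDrift R K p)
    (hR : ∀ k, LipschitzWith 1 (R k)) (hp : Tendsto (fun k => R k p) atTop (𝓝 p)) {S : Set X}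
    (hS : IsClosed S) (hSne : S.Nonempty) (hSK : ∀ᶠ q in 𝓝[S] p, q - p ∈ K) :
    ∀ᶠ ε in 𝓝[>] 0, ∀ᶠ m in atTop, ∀ z : ℕ → X, (∀ k ≥ m, z (k + 1) = R k (z k)) →
      ‖z m - p‖ ≤ ε → Metric.infDist (z m) S ≤ ε →
      (∀ k ≥ m, ‖z k - p‖ ≤ 4 * ε → Metric.infDist (z k) S ≤ ε →
        Metric.infDist (z (k + 1)) S ≤ ε) →
      ∀ k ≥ m, ‖z k - p‖ ≤ 4 * ε := by
  obtain ⟨e, he, hRe⟩ := hdrift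
  obtain ⟨late, hlate, near, hnear, hRe⟩ := eventually_prod_iff.1 hRe
  filter_upwards [self_mem_nhdsWithin, eventually_forall_norm_sub_le hnear 4,
    eventually_forall_norm_sub_le (eventually_nhdsWithin_iff.1 hSK) 6] with ε hε hnear hSK
  filter_upwards [eventually_forall_sum_Ico_lt he hε, eventually_forall_ge_atTop.2 hlate,
    eventually_forall_ge_atTop.2
      ((tendsto_iff_norm_sub_tendsto_zero.1 hp).eventually_le_const hε)]
    with m hsum hlate hRp z hz hm hSm hinv k hk
  refine (norm_sub_le_of_sum_drift_le hS hSne hε.le (fun q hq hqp => hSK q hqp hq) hm hSm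
    (fun n => (hsum n).le) (fun k hk hzk hSk => ⟨?_, hinv k hk hzk hSk, ?_⟩) hk).1
  · have hlip := (hR k).dist_le_mul (z k) p
    rw [NNReal.coe_one, one_mul, dist_eq_norm, dist_eq_norm, ← hz k hk] at hlip
    linarith [hRp k hk, norm_sub_le_norm_sub_add_norm_sub (z (k + 1)) (R k p) p]
  · rw [hz k hk]
    exact hRe (hlate k hk) (hnear _ hzk)

end Drift

section Convergence

variable {X : Type*} [NormedAddCommGroup X] [InnerProductSpace ℝ X] [FiniteDimensional ℝ X]
  {R : ℕ → X → X} {T : X → X} {c : X → ℕ} {K : X → Submodule ℝ X}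

theorem exists_isBounded_orbit (hR : ∀ k, LipschitzWith 1 (R k))
    (hRT : ∀ x, Tendsto (fun k => R k x) atTop (𝓝 (T x))) (hT : IsParacontracting T)
    (hfix : (Function.fixedPoints T).Nonempty)
    (hdrift : ∀ p ∈ Function.fixedPoints T, HasSummableDrift R (K p) p)
    (hstrat : ∀ p ∈ Function.fixedPoints T, ∀ᶠ q in 𝓝[Function.fixedPoints T] p,
      c p ≤ c q → q - p ∈ K p) :
    ∃ (w : ℕ → X) (m : ℕ) (p : X) (r : ℝ), (∀ k ≥ m, w (k + 1) = R k (w k)) ∧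
      ∀ k ≥ m, dist (w k) p ≤ r := by
  have hcont := (lipschitzWith_of_tendsto hR hRT).continuous
  have hclosed := isClosed_fixedPoints hcont
  obtain ⟨p, hp, hmin⟩ := (InvImage.wf c wellFounded_lt).has_min _ hfix
  have hpK : ∀ᶠ q in 𝓝[Function.fixedPoints T] p, q - p ∈ K p := by
    filter_upwards [hstrat p hp, self_mem_nhdsWithin] with q hq hqfix
    exact hq (not_lt.1 (hmin q hqfix))
  obtain ⟨ε, hconf, hε⟩ := (((hdrift p hp).eventually_confined hR
    (by simpa only [hp.eq] using hRT p) hclosed hfix hpK).and self_mem_nhdsWithin).exists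
  have hcompact : IsCompact (Metric.closedBall p (4 * ε) ∩
      {x | Metric.infDist x (Function.fixedPoints T) ≤ ε}) :=
    (isCompact_closedBall p _).inter_right
      (isClosed_le (Metric.continuous_infDist_pt _) continuous_const)
  have hinv := eventually_forall_mem_of_lipschitzWith hR (fun x _ => hRT x) hcompact
    (isOpen_lt (Metric.continuous_infDist_pt (Function.fixedPoints T)) (continuous_const (y := ε)))
    fun x hx => by
      by_cases hxfix : x ∈ Function.fixedPoints T
      · rw [Set.mem_ofPred_eq, hxfix.eq, Metric.infDist_zero_of_mem hxfix]
        exact hε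
      · exact (hT.infDist_fixedPoints_lt hcont hfix hxfix).trans_le hx.2
  obtain ⟨m, hm, hinv⟩ := (hconf.and (eventually_forall_ge_atTop.2 hinv)).exists
  obtain ⟨w, hwm, hw⟩ := exists_orbit_from R m p
  have hε0 : 0 ≤ ε := (Set.mem_Ioi.1 hε).le
  refine ⟨w, m, p, 4 * ε, hw, fun k hk => ?_⟩
  rw [dist_eq_norm]
  refine hm w hw (by simpa [hwm] using hε0)
    (by rwa [hwm, Metric.infDist_zero_of_mem hp]) (fun k hk hwk hSk => ?_) k hk
  rw [hw k hk]
  exact (hinv k hk _ ⟨mem_closedBall_iff_norm.2 hwk, hSk⟩).le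

theorem exists_tendsto_fixedPoint_of_summable_drift (hR : ∀ k, LipschitzWith 1 (R k))
    (hRT : ∀ x, Tendsto (fun k => R k x) atTop (𝓝 (T x))) (hT : IsParacontracting T)
    (hfix : (Function.fixedPoints T).Nonempty)
    (hdrift : ∀ p ∈ Function.fixedPoints T, HasSummableDrift R (K p) p)
    (hstrat : ∀ p ∈ Function.fixedPoints T, ∀ᶠ q in 𝓝[Function.fixedPoints T] p,
      c p ≤ c q → q - p ∈ K p)
    {z : ℕ → X} (hz : ∀ k, z (k + 1) = R k (z k)) :
    ∃ p ∈ Function.fixedPoints T, Tendsto z atTop (𝓝 p) := by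
  obtain ⟨w, m, q, r, hw, hwr⟩ := exists_isBounded_orbit hR hRT hT hfix hdrift hstrat
  have hbdd := isBounded_range_of_isBounded_orbit hR hz hw hwr
  have hclusterFix : {y | MapClusterPt y atTop z} ⊆ Function.fixedPoints T := fun y hy =>
    isFixedPt_of_mapClusterPt hR hRT hT hfix hz hbdd hy
  have hcluster := exists_mapClusterPt_of_isBounded_range hbdd
  obtain ⟨p, hp, hmin⟩ := (InvImage.wf c wellFounded_lt).has_min _ hcluster
  have hpK : ∀ᶠ q in 𝓝[{y | MapClusterPt y atTop z}] p, q - p ∈ K p := by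
    filter_upwards [(hstrat p (hclusterFix hp)).filter_mono (nhdsWithin_mono p hclusterFix),
      self_mem_nhdsWithin] with q hq hqz
    exact hq (not_lt.1 (hmin q hqz))
  have hconf := (hdrift p (hclusterFix hp)).eventually_confined hR
    (by simpa only [(hclusterFix hp).eq] using hRT p) isClosed_setOfPred_clusterPt hcluster hpK
  refine ⟨p, hclusterFix hp, Metric.tendsto_atTop.2 fun ε₀ hε₀ => ?_⟩
  obtain ⟨ε, hconf, hε, hεε₀⟩ := (hconf.and (Ioo_mem_nhdsGT (by positivity : 0 < ε₀ / 4))).exists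
  have hdist := (tendsto_infDist_clusterSet hbdd).eventually_le_const hε
  have hnear := (show MapClusterPt p atTop z from hp).frequently (Metric.closedBall_mem_nhds p hε)
  obtain ⟨m, hzm, hm, hdist⟩ := (hnear.and_eventually
    (hconf.and (eventually_forall_ge_atTop.2 hdist))).exists
  refine ⟨m, fun k hk => ?_⟩
  rw [dist_eq_norm]
  exact (hm z (fun k _ => hz k) (mem_closedBall_iff_norm.1 hzm) (hdist m le_rfl)
    (fun k hk _ _ => hdist (k + 1) (hk.trans k.le_succ)) k hk).trans_lt (by linarith)

end Convergence

/-- The `k`-th of a sequence of HLWB sweeps, as a function of its anchor: it starts at `y k` and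
makes `n k` steps. -/
noncomputable def hlwbSweep {E : Type*} [NormedAddCommGroup E] [NormedSpace ℝ E] {N : ℕ} [NeZero N]
    (lam : ℕ → ℝ) (C : Fin N → Set E) (y : ℕ → E) (n : ℕ → ℕ) (k : ℕ) (x : E) : E :=
  hlwb lam C x (y k) (n k)

section Sweep

variable {E : Type*} [NormedAddCommGroup E] [InnerProductSpace ℝ E] {N : ℕ} [NeZero N]
  {lam : ℕ → ℝ} {C : Fin N → Set E} {y : ℕ → E} {n : ℕ → ℕ}

theorem lipschitzWith_hlwbSweep [CompleteSpace E] (hlam : IsSteeringSequence N lam)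
    (hC : ∀ i, IsNonemptyClosedConvex (C i)) (k : ℕ) : LipschitzWith 1 (hlwbSweep lam C y n k) :=
  lipschitzWith_hlwb_anchor hlam.mem_Icc hC (y k) (n k)

theorem tendsto_hlwb_of_isBounded [ProperSpace E] (hlam : IsSteeringSequence N lam)
    (hC : ∀ i, IsNonemptyClosedConvex (C i)) (hne : (⋂ i, C i).Nonempty) {s : Set E}
    (hs : Bornology.IsBounded s) (p : E) :
    Tendsto (fun q : ℕ × E × E => hlwb lam C q.2.1 q.2.2 q.1) (atTop ×ˢ 𝓝 p ×ˢ 𝓟 s)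
      (𝓝 (metricProj (⋂ i, C i) p)) := by
  obtain ⟨r, hr⟩ := hs.subset_closedBall p
  have hfactor := (tendsto_contractionFactor hlam.mem_Icc hlam.not_summable 0).mul_const r
  have hlim := tendsto_iff_norm_sub_tendsto_zero.1 (tendsto_hlwb hlam hC hne p p)
  have hanchor := tendsto_iff_norm_sub_tendsto_zero.1 (tendsto_id (x := 𝓝 p))
  have hbound := ((hanchor.comp (tendsto_fst.comp tendsto_snd)).add
    (hfactor.comp tendsto_fst)).add (hlim.comp (tendsto_fst (g := 𝓝 p ×ˢ 𝓟 s)))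
  simp only [zero_mul, add_zero] at hbound
  have hstart : ∀ᶠ q : ℕ × E × E in atTop ×ˢ 𝓝 p ×ˢ 𝓟 s, q.2.2 ∈ s :=
    (tendsto_snd.comp tendsto_snd).eventually (eventually_mem_principal s)
  refine tendsto_iff_norm_sub_tendsto_zero.2
    (squeeze_zero' (.of_forall fun _ => norm_nonneg _) ?_ hbound)
  filter_upwards [hstart] with ⟨j, a, x⟩ hx
  have hcf := contractionFactor_mem_Icc (m := 0) (n := j) hlam.mem_Icc
  refine (norm_sub_le_norm_sub_add_norm_sub _ (hlwb lam C p p j) _).trans (add_le_add_left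
    ((norm_hlwb_sub_hlwb_le hlam.mem_Icc hC a p x p j).trans (add_le_add ?_ ?_)) _)
  · exact mul_le_of_le_one_left (norm_nonneg _) (sub_le_self _ hcf.1)
  · exact mul_le_mul_of_nonneg_left (mem_closedBall_iff_norm.1 (hr hx)) hcf.1

theorem tendsto_hlwbSweep [ProperSpace E] (hlam : IsSteeringSequence N lam)
    (hC : ∀ i, IsNonemptyClosedConvex (C i)) (hne : (⋂ i, C i).Nonempty)
    (hy : Bornology.IsBounded (Set.range y)) (hn : Tendsto n atTop atTop) (x : E) :
    Tendsto (fun k => hlwbSweep lam C y n k x) atTop (𝓝 (metricProj (⋂ i, C i) x)) :=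
  (tendsto_hlwb_of_isBounded hlam hC hne hy x).comp (hn.prodMk (tendsto_const_nhds.prodMk
    (tendsto_principal.2 (.of_forall Set.mem_range_self))))

theorem starProjection_hlwb_sub {K : Submodule ℝ E} [K.HasOrthogonalProjection] {a x : E}
    {m n : ℕ} (hmn : m ≤ n) (hK : ∀ j ≥ m, ∀ i,
      K.starProjection (hlwb lam C a x j - metricProj (C i) (hlwb lam C a x j)) = 0) :
    K.starProjection (hlwb lam C a x n - a) =
      contractionFactor lam m n • K.starProjection (hlwb lam C a x m - a) := by
  induction n, hmn using Nat.le_induction with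
  | base => rw [contractionFactor_self, one_smul]
  | succ n hn ih =>
    rw [contractionFactor_succ hn, mul_smul, ← ih, hlwb_succ_sub, sub_self, smul_zero, zero_add,
      map_smul, ← sub_sub_sub_cancel_left _ _ (hlwb lam C a x n), map_sub, hK n hn, sub_zero]

theorem hasSummableDrift_hlwbSweep [ProperSpace E] (hlam : IsSteeringSequence N lam)
    (hC : ∀ i, IsNonemptyClosedConvex (C i)) (hne : (⋂ i, C i).Nonempty)
    (hy : Bornology.IsBounded (Set.range y)) (hn : Tendsto n atTop atTop)
    (hsum : ∀ m, Summable fun k => contractionFactor lam m (n k)) {K : Submodule ℝ E}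
    [K.HasOrthogonalProjection] {p : E} (hK : ∀ᶠ x in 𝓝 (metricProj (⋂ i, C i) p), ∀ i,
      K.starProjection (x - metricProj (C i) x) = 0) :
    HasSummableDrift (hlwbSweep lam C y n) K p := by
  have hlim := tendsto_hlwb_of_isBounded hlam hC hne hy p
  have hbound := ((hlim.sub (tendsto_fst.comp tendsto_snd)).norm).eventually_lt_const
    (lt_add_one ‖metricProj (⋂ i, C i) p - p‖)
  obtain ⟨late, hlate, good, hgood, h⟩ := eventually_prod_iff.1 ((hlim.eventually hK).and hbound)
  obtain ⟨near, hnear, start, hstart, hpair⟩ := eventually_prod_iff.1 hgood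
  obtain ⟨m, hm⟩ := eventually_atTop.1 hlate
  refine ⟨fun k => contractionFactor lam m (n k) * (‖metricProj (⋂ i, C i) p - p‖ + 1),
    (hsum m).mul_right _, ?_⟩
  filter_upwards [(hn.eventually_ge_atTop m).prod_mk hnear] with ⟨k, a⟩ ⟨hk, ha⟩
  have hq := fun j (hj : j ≥ m) => h (hm j hj) (hpair ha (eventually_principal.1 hstart _ ⟨k, rfl⟩))
  have hcf := (contractionFactor_mem_Icc (m := m) (n := n k) hlam.mem_Icc).1
  rw [hlwbSweep, starProjection_hlwb_sub hk fun j hj => (hq j hj).1, norm_smul_of_nonneg hcf]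
  exact mul_le_mul_of_nonneg_left
    ((K.norm_starProjection_apply_le _).trans (hq m le_rfl).2.le) hcf

end Sweep

/-- The half-space `{x | ⟪u, x⟫ ≤ c}`; it is empty or everything if `u = 0`. -/
def halfSpace {E : Type*} [NormedAddCommGroup E] [InnerProductSpace ℝ E] (u : E) (c : ℝ) : Set E :=
  {x | inner ℝ u x ≤ c}

/-- The indices of the constraints `⟪u i, x⟫ ≤ c i` of a polyhedron that hold with equality. -/
def activeSet {ι E : Type*} [NormedAddCommGroup E] [InnerProductSpace ℝ E] (u : ι → E) (c : ι → ℝ)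
    (x : E) : Set ι :=
  {i | inner ℝ (u i) x = c i}

/-- The directions orthogonal to all constraints active at `x`: for `x` in the polyhedron, the
directions parallel to the face having `x` in its relative interior. -/
noncomputable def faceDirection {ι E : Type*} [NormedAddCommGroup E] [InnerProductSpace ℝ E]
    (u : ι → E) (c : ι → ℝ) (x : E) : Submodule ℝ E :=
  ⨅ i ∈ activeSet u c x, (innerSL ℝ (u i)).ker

section Polyhedron

variable {ι E : Type*} [NormedAddCommGroup E] [InnerProductSpace ℝ E] {u : ι → E} {c : ι → ℝ}
  {C : Set E} {x y : E}

theorem exists_eq_halfSpace {C : ι → Set E}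
    (hC : ∀ i, IsClosedHalfSpace (C i) ∨ C i = Set.univ) :
    ∃ (u : ι → E) (c : ι → ℝ), C = fun i => halfSpace (u i) (c i) := by
  have hsingle : ∀ i, ∃ (u : E) (c : ℝ), C i = halfSpace u c := fun i => by
    rcases hC i with ⟨u, c, -, h⟩ | h
    · exact ⟨u, c, h⟩
    · exact ⟨0, 0, by simp [h, halfSpace]⟩
  choose u c h using hsingle
  exact ⟨u, c, funext h⟩

theorem isClosed_halfSpace (u : E) (c : ℝ) : IsClosed (halfSpace u c) :=
  isClosed_le (by fun_prop) continuous_const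

theorem isNonemptyClosedConvex_halfSpace {u : E} {c : ℝ} (hne : (halfSpace u c).Nonempty) :
    IsNonemptyClosedConvex (halfSpace u c) where
  nonempty := hne
  isClosed := isClosed_halfSpace u c
  convex := convex_halfSpace_le (innerSL ℝ u).toLinearMap.isLinear c

theorem isNonemptyClosedConvex_halfSpace_of_iInter
    (hne : (⋂ i, halfSpace (u i) (c i)).Nonempty) (i : ι) :
    IsNonemptyClosedConvex (halfSpace (u i) (c i)) :=
  isNonemptyClosedConvex_halfSpace (hne.mono (Set.iInter_subset _ i))

theorem mem_faceDirection {v : E} :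
    v ∈ faceDirection u c x ↔ ∀ i ∈ activeSet u c x, inner ℝ (u i) v = 0 := by
  simp [faceDirection]

theorem sub_mem_faceDirection (h : activeSet u c x ⊆ activeSet u c y) :
    y - x ∈ faceDirection u c x :=
  mem_faceDirection.2 fun i hi => by rw [inner_sub_right, h hi, hi, sub_self]

theorem eventually_activeSet_subset [Finite ι] (u : ι → E) (c : ι → ℝ) (x : E) :
    ∀ᶠ y in 𝓝 x, activeSet u c y ⊆ activeSet u c x := by
  have hinactive : ∀ᶠ y in 𝓝 x, ∀ i, i ∉ activeSet u c x → i ∉ activeSet u c y := by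
    refine eventually_all.2 fun i => eventually_imp_distrib_left.2 fun hi => ?_
    exact (continuousAt_const.inner continuousAt_id).eventually_ne hi
  exact hinactive.mono fun y hy i => not_imp_not.1 (hy i)

theorem starProjection_sub_metricProj_eq_zero [CompleteSpace E] (hC : IsNonemptyClosedConvex C)
    {K : Submodule ℝ E} [K.HasOrthogonalProjection]
    (hK : ∀ v ∈ K, metricProj C x + v ∈ C) : K.starProjection (x - metricProj C x) = 0 := by
  rw [Submodule.starProjection_apply_eq_zero_iff, Submodule.mem_orthogonal']
  have hle : ∀ v ∈ K, inner ℝ (x - metricProj C x) v ≤ 0 := fun v hv => by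
    simpa using hC.inner_sub_metricProj_le_zero x (hK v hv)
  refine fun v hv => le_antisymm (hle v hv) ?_
  simpa using hle (-v) (K.neg_mem hv)

theorem eventually_starProjection_sub_metricProj_halfSpace_eq_zero [Finite ι] [CompleteSpace E]
    {K : Submodule ℝ E} [K.HasOrthogonalProjection] (hK : K ≤ faceDirection u c x)
    (hx : ∀ i, x ∈ halfSpace (u i) (c i)) :
    ∀ᶠ y in 𝓝 x, ∀ i, K.starProjection (y - metricProj (halfSpace (u i) (c i)) y) = 0 := by
  refine eventually_all.2 fun i => ?_
  have hC := isNonemptyClosedConvex_halfSpace ⟨x, hx i⟩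
  by_cases hi : i ∈ activeSet u c x
  · refine .of_forall fun y => starProjection_sub_metricProj_eq_zero hC fun v hv => ?_
    rw [halfSpace, Set.mem_ofPred_eq, inner_add_right, mem_faceDirection.1 (hK hv) i hi, add_zero]
    exact hC.metricProj_mem y
  · have hlt := (continuousAt_const.inner continuousAt_id).eventually_lt_const
      (lt_of_le_of_ne (hx i) hi)
    filter_upwards [hlt] with y hy
    rw [hC.metricProj_eq_self (x := y) hy.le, sub_self, map_zero]

theorem eventually_sub_mem_faceDirection [Finite ι] {κ : Type*} [Finite κ] {v : κ → E}
    {d : κ → ℝ} {g : E → E} (hg : ContinuousAt g x) :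
    ∀ᶠ y in 𝓝 x, (activeSet u c x).ncard + (activeSet v d (g x)).ncard ≤
        (activeSet u c y).ncard + (activeSet v d (g y)).ncard →
      y - x ∈ faceDirection u c x ∧ g y - g x ∈ faceDirection v d (g x) := by
  filter_upwards [eventually_activeSet_subset u c x,
    hg.eventually (eventually_activeSet_subset v d (g x))] with y hu hv hcard
  have hu' := Set.ncard_le_ncard hu
  have hv' := Set.ncard_le_ncard hv
  exact ⟨sub_mem_faceDirection (Set.eq_of_subset_of_ncard_le hu (by omega)).ge,
    sub_mem_faceDirection (Set.eq_of_subset_of_ncard_le hv (by omega)).ge⟩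

end Polyhedron

section PolyhedronImage

theorem map_eq_zero_of_tendsto_inv_norm_smul {Y Z : Type*} [NormedAddCommGroup Y]
    [NormedSpace ℝ Y] [NormedAddCommGroup Z] [NormedSpace ℝ Z] {z : ℕ → Y} {w : Y}
    (hz : Tendsto (fun n => ‖z n‖) atTop atTop)
    (hw : Tendsto (fun n => ‖z n‖⁻¹ • z n) atTop (𝓝 w)) {M : Y →L[ℝ] Z} {y : Z}
    (hM : Tendsto (fun n => M (z n)) atTop (𝓝 y)) : M w = 0 := by
  have hlim := hz.inv_tendsto_atTop.smul hM
  rw [zero_smul] at hlim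
  exact tendsto_nhds_unique ((M.continuous.tendsto w).comp hw)
    (hlim.congr fun n => (M.map_smul _ _).symm)

variable {ι Y Z : Type*} [NormedAddCommGroup Y] [InnerProductSpace ℝ Y] [NormedAddCommGroup Z]
  [NormedSpace ℝ Z] {u : ι → Y} {c : ι → ℝ} {z : ℕ → Y} {w : Y}

theorem eventually_norm_sub_lt_of_tendsto_inv_norm_smul
    (hz : Tendsto (fun n => ‖z n‖) atTop atTop)
    (hw : Tendsto (fun n => ‖z n‖⁻¹ • z n) atTop (𝓝 w)) (hw1 : ‖w‖ = 1) :
    ∀ᶠ n in atTop, ‖z n - w‖ < ‖z n‖ := by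
  have hinner : Tendsto (fun n => inner ℝ (‖z n‖⁻¹ • z n) w) atTop (𝓝 1) := by
    simpa [hw1] using hw.inner (𝕜 := ℝ) (tendsto_const_nhds (x := w))
  filter_upwards [(hz.atTop_mul_pos one_pos hinner).eventually_gt_atTop 1,
    hz.eventually_gt_atTop 0] with n hn hpos
  rw [real_inner_smul_left, mul_inv_cancel_left₀ hpos.ne'] at hn
  refine lt_of_pow_lt_pow_left₀ 2 (norm_nonneg _) ?_
  rw [norm_sub_sq_real, hw1]
  linarith

theorem eventually_sub_mem_of_tendsto_inv_norm_smul [Finite ι]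
    (hz : Tendsto (fun n => ‖z n‖) atTop atTop)
    (hw : Tendsto (fun n => ‖z n‖⁻¹ • z n) atTop (𝓝 w))
    (hzP : ∀ n, z n ∈ ⋂ i, halfSpace (u i) (c i)) :
    ∀ᶠ n in atTop, z n - w ∈ ⋂ i, halfSpace (u i) (c i) := by
  simp only [Set.mem_iInter, halfSpace, Set.mem_ofPred_eq, inner_sub_right] at hzP ⊢
  refine eventually_all.2 fun i => ?_
  have hinner := (tendsto_const_nhds (x := u i)).inner (𝕜 := ℝ) hw
  have hle : inner ℝ (u i) w ≤ 0 := by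
    have hc := hz.inv_tendsto_atTop.mul_const (c i)
    rw [zero_mul] at hc
    refine le_of_tendsto_of_tendsto' hinner hc fun n => ?_
    rw [real_inner_smul_right]
    exact mul_le_mul_of_nonneg_left (hzP n i) (inv_nonneg.2 (norm_nonneg _))
  rcases hle.lt_or_eq with hlt | heq
  · filter_upwards [(hz.atTop_mul_neg hlt hinner).eventually_le_atBot (c i + inner ℝ (u i) w),
      hz.eventually_gt_atTop 0] with n hn hpos
    rw [real_inner_smul_right, mul_inv_cancel_left₀ hpos.ne'] at hn
    linarith
  · exact .of_forall fun n => by simpa [heq] using hzP n i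

-- Otherwise subtracting a limit direction would give shorter elements of the same fibres.
theorem not_tendsto_norm_atTop_of_minimal [Finite ι] [ProperSpace Y] {M : Y →L[ℝ] Z} {y : Z}
    (hzP : ∀ n, z n ∈ ⋂ i, halfSpace (u i) (c i))
    (hmin : ∀ n, ∀ x ∈ ⋂ i, halfSpace (u i) (c i), M x = M (z n) → ‖z n‖ ≤ ‖x‖)
    (hM : Tendsto (fun n => M (z n)) atTop (𝓝 y)) :
    ¬Tendsto (fun n => ‖z n‖) atTop atTop := by
  intro hz
  obtain ⟨w, -, φ, hφ, hw⟩ := (isCompact_closedBall (0 : Y) 1).tendsto_subseq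
    (x := fun n => ‖z n‖⁻¹ • z n) fun n => by
      rw [mem_closedBall_zero_iff, norm_smul, norm_inv, norm_norm]
      exact inv_mul_le_one
  have hzφ := hz.comp hφ.tendsto_atTop
  have hw1 : ‖w‖ = 1 := by
    refine tendsto_nhds_unique hw.norm (tendsto_const_nhds.congr' ?_)
    filter_upwards [hzφ.eventually_gt_atTop 0] with n hn
    exact (norm_smul_inv_norm (𝕜 := ℝ) (norm_pos_iff.1 hn)).symm
  have hMw := map_eq_zero_of_tendsto_inv_norm_smul hzφ hw (hM.comp hφ.tendsto_atTop)
  obtain ⟨n, hmem, hlt⟩ := ((eventually_sub_mem_of_tendsto_inv_norm_smul hzφ hw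
    fun n => hzP (φ n)).and (eventually_norm_sub_lt_of_tendsto_inv_norm_smul hzφ hw hw1)).exists
  exact hlt.not_ge (hmin (φ n) _ hmem (by rw [map_sub, hMw, sub_zero]))

theorem isClosed_image_iInter_halfSpace [Finite ι] [ProperSpace Y] (u : ι → Y) (c : ι → ℝ)
    (M : Y →L[ℝ] Z) : IsClosed (M '' ⋂ i, halfSpace (u i) (c i)) := by
  have hclosed := isClosed_iInter fun i => isClosed_halfSpace (u i) (c i)
  set P := ⋂ i, halfSpace (u i) (c i)
  have hminimal : ∀ v ∈ M '' P, ∃ z ∈ P, M z = v ∧ ∀ x ∈ P, M x = v → ‖z‖ ≤ ‖x‖ := fun v hv => by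
    obtain ⟨z, ⟨hzP, hzv⟩, hdist⟩ := (hclosed.inter (isClosed_singleton.preimage
      M.continuous)).exists_infDist_eq_dist hv 0
    refine ⟨z, hzP, hzv, fun x hx hxv => ?_⟩
    rw [← dist_zero_left, ← dist_zero_left x, ← hdist]
    exact Metric.infDist_le_dist_of_mem ⟨hx, hxv⟩
  refine isClosed_of_closure_subset fun y hy => ?_
  obtain ⟨v, hv, hvy⟩ := mem_closure_iff_seq_limit.1 hy
  choose z hzP hzv hmin using fun n => hminimal (v n) (hv n)
  have hnot := not_tendsto_norm_atTop_of_minimal hzP (fun n x hx hxz =>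
    hmin n x hx (hxz.trans (hzv n))) (by simpa only [hzv] using hvy)
  obtain ⟨r, hr⟩ := not_forall.1 (mt tendsto_atTop.2 hnot)
  obtain ⟨x, -, φ, hφ, hx⟩ := tendsto_subseq_of_frequently_bounded Metric.isBounded_closedBall
    ((not_eventually.1 hr).mono fun n hn => mem_closedBall_zero_iff.2 (not_le.1 hn).le)
  refine ⟨x, hclosed.mem_of_tendsto hx (.of_forall fun n => hzP (φ n)), ?_⟩
  refine tendsto_nhds_unique ((M.continuous.tendsto x).comp hx) ?_
  exact (hvy.comp hφ.tendsto_atTop).congr fun n => (hzv (φ n)).symm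

end PolyhedronImage

section BestApproxPair

variable {E : Type*} [NormedAddCommGroup E] [InnerProductSpace ℝ E]

theorem exists_isBestApproxPair_iInter_halfSpace {ι κ : Type*} [Finite ι] [Finite κ]
    [FiniteDimensional ℝ E] {u : ι → E} {c : ι → ℝ} {v : κ → E} {d : κ → ℝ}
    (hA : (⋂ i, halfSpace (u i) (c i)).Nonempty) (hB : (⋂ j, halfSpace (v j) (d j)).Nonempty) :
    ∃ p, IsBestApproxPair (⋂ i, halfSpace (u i) (c i)) (⋂ j, halfSpace (v j) (d j)) p := by
  set A := ⋂ i, halfSpace (u i) (c i)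
  set B := ⋂ j, halfSpace (v j) (d j)
  obtain ⟨x, hx⟩ := hA
  obtain ⟨y, hy⟩ := hB
  have hmem : ∀ z : WithLp 2 (E × E), (z ∈ ⋂ k, halfSpace
      (Sum.elim (fun i => WithLp.toLp 2 (u i, (0 : E))) (fun j => WithLp.toLp 2 ((0 : E), v j)) k)
      (Sum.elim c d k)) ↔ z.fst ∈ A ∧ z.snd ∈ B := by
    simp [A, B, halfSpace, Sum.forall, WithLp.prod_inner_apply]
  obtain ⟨_, ⟨p, hp, rfl⟩, hmin⟩ := (isClosed_image_iInter_halfSpace _ _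
    (WithLp.fstL 2 ℝ E E - WithLp.sndL 2 ℝ E E)).exists_infDist_eq_dist
    ⟨_, WithLp.toLp 2 (x, y), (hmem _).2 ⟨hx, hy⟩, rfl⟩ 0
  refine ⟨(p.fst, p.snd), ((hmem p).1 hp).1, ((hmem p).1 hp).2, fun x hx y hy => ?_⟩
  have hle := Metric.infDist_le_dist_of_mem (x := 0) (Set.mem_image_of_mem
    (WithLp.fstL 2 ℝ E E - WithLp.sndL 2 ℝ E E) ((hmem (WithLp.toLp 2 (x, y))).2 ⟨hx, hy⟩))
  rwa [hmin, dist_zero_left, dist_zero_left] at hle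

variable [CompleteSpace E] {A B : Set E}

theorem IsBestApproxPair.metricProj_snd_eq (hA : IsNonemptyClosedConvex A) {p : E × E}
    (hp : IsBestApproxPair A B p) : metricProj A p.2 = p.1 :=
  (metricProj_eq_iff hA.nonempty hA.isClosed hA.convex _ _).2 ⟨hp.1, fun x hx => by
    simpa only [norm_sub_rev p.2] using hp.2.2 x hx p.2 hp.2.1⟩

theorem IsBestApproxPair.metricProj_fst_eq (hB : IsNonemptyClosedConvex B) {p : E × E}
    (hp : IsBestApproxPair A B p) : metricProj B p.1 = p.2 :=
  (metricProj_eq_iff hB.nonempty hB.isClosed hB.convex _ _).2 ⟨hp.2.1, hp.2.2 p.1 hp.1⟩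

theorem isFixedPt_of_isBestApproxPair (hA : IsNonemptyClosedConvex A)
    (hB : IsNonemptyClosedConvex B) {p : E × E} (hp : IsBestApproxPair A B p) :
    p.1 ∈ Function.fixedPoints (metricProj A ∘ metricProj B) := by
  rw [Function.mem_fixedPoints, Function.IsFixedPt, Function.comp_apply, hp.metricProj_fst_eq hB,
    hp.metricProj_snd_eq hA]

theorem isBestApproxPair_of_isFixedPt (hA : IsNonemptyClosedConvex A)
    (hB : IsNonemptyClosedConvex B) {p : E}
    (hp : p ∈ Function.fixedPoints (metricProj A ∘ metricProj B)) :
    IsBestApproxPair A B (p, metricProj B p) := by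
  have hfix : metricProj A (metricProj B p) = p := hp
  refine ⟨hfix ▸ hA.metricProj_mem _, hB.metricProj_mem p, fun x hx y hy => ?_⟩
  have hy' := hB.inner_sub_metricProj_le_zero p hy
  have hx' := hA.inner_sub_metricProj_le_zero (metricProj B p) hx
  rw [hfix] at hx'
  set q := metricProj B p
  have hsplit : ‖p - q‖ ^ 2 = inner ℝ (p - q) (x - y) + inner ℝ (p - q) (y - q) +
      inner ℝ (q - p) (x - p) := by
    rw [← real_inner_self_eq_norm_sq, ← neg_sub p q, inner_neg_left, ← inner_add_right,
      ← sub_eq_add_neg, ← inner_sub_right]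
    congr 1
    abel
  have hsq : ‖p - q‖ * ‖p - q‖ ≤ ‖p - q‖ * ‖x - y‖ := by
    linarith [real_inner_le_norm (p - q) (x - y)]
  rcases (norm_nonneg (p - q)).eq_or_lt with h0 | hpos
  · exact h0 ▸ norm_nonneg _
  · exact le_of_mul_le_mul_left hsq hpos

theorem isParacontracting_metricProj_comp (hA : IsNonemptyClosedConvex A)
    (hB : IsNonemptyClosedConvex B) : IsParacontracting (metricProj A ∘ metricProj B) := by
  intro p hp x hx
  have hfix : metricProj A (metricProj B p) = p := hp
  refine lt_of_not_ge fun hle => hx ?_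
  rw [dist_eq_norm, dist_eq_norm, Function.comp_apply] at hle
  have hPA := hA.norm_metricProj_sub_metricProj_le (metricProj B x) (metricProj B p)
  have hPB := hB.norm_metricProj_sub_metricProj_le x p
  rw [hfix] at hPA
  have hB' := hB.sub_metricProj_eq_of_norm_le (hle.trans hPA)
  have hA' := hA.sub_metricProj_eq_of_norm_le (x := metricProj B x) (y := metricProj B p)
    (by rw [hfix]; exact hPB.trans hle)
  rw [hfix] at hA'
  refine (sub_eq_zero.1 ?_).symm
  rw [Function.comp_apply, ← sub_add_sub_cancel x (metricProj B x), hB', hA']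
  abel

theorem metricProj_sub_metricProj_of_isFixedPt (hA : IsNonemptyClosedConvex A)
    (hB : IsNonemptyClosedConvex B) {p q : E}
    (hp : p ∈ Function.fixedPoints (metricProj A ∘ metricProj B))
    (hq : q ∈ Function.fixedPoints (metricProj A ∘ metricProj B)) :
    metricProj B q - metricProj B p = q - p := by
  have hle := hA.norm_metricProj_sub_metricProj_le (metricProj B q) (metricProj B p)
  rw [show metricProj A (metricProj B p) = p from hp,
    show metricProj A (metricProj B q) = q from hq] at hle
  exact (sub_eq_sub_iff_sub_eq_sub.1 (hB.sub_metricProj_eq_of_norm_le hle)).symm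

end BestApproxPair

theorem summable_contractionFactor {lam : ℕ → ℝ} (h01 : ∀ n, lam (n + 1) ∈ Set.Icc 0 1)
    {nk : ℕ → ℕ} (hmono : Monotone nk) (hlim : Tendsto nk atTop atTop)
    (h : (⨆ k₀ : ℕ, ∑' k : Set.Ioi k₀,
      ENNReal.ofReal (∏ n ∈ Finset.Ioc (nk k₀) (nk k), (1 - lam n))) < ⊤) (m : ℕ) :
    Summable fun k => contractionFactor lam m (nk k) := by
  obtain ⟨k₀, hk₀⟩ := (hlim.eventually_ge_atTop m).exists
  have htail := ENNReal.summable_toReal ((le_iSup (fun k₀ : ℕ => ∑' k : Set.Ioi k₀,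
    ENNReal.ofReal (∏ n ∈ Finset.Ioc (nk k₀) (nk k), (1 - lam n))) k₀).trans_lt h).ne
  have hinj : Function.Injective fun j : ℕ =>
      (⟨j + (k₀ + 1), Set.mem_Ioi.2 (Nat.lt_add_left j k₀.lt_succ_self)⟩ : Set.Ioi k₀) :=
    fun i j hij => add_right_cancel (Subtype.ext_iff.1 hij)
  rw [← summable_nat_add_iff (k₀ + 1)]
  refine ((htail.comp_injective hinj).mul_left (contractionFactor lam m (nk k₀))).congr fun j => ?_
  have hfactor : (ENNReal.ofReal (contractionFactor lam (nk k₀) (nk (j + (k₀ + 1))))).toReal =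
      contractionFactor lam (nk k₀) (nk (j + (k₀ + 1))) :=
    ENNReal.toReal_ofReal (contractionFactor_mem_Icc h01).1
  exact (congrArg _ hfactor).trans (Finset.prod_Ioc_consecutive _ hk₀ (hmono (by omega)))

section AlternatingSweeps

variable {E : Type*} [NormedAddCommGroup E] [InnerProductSpace ℝ E] [FiniteDimensional ℝ E]
  {N : ℕ} [NeZero N] {lam : ℕ → ℝ}

theorem hasSummableDrift_hlwbSweep_halfSpace (hlam : IsSteeringSequence N lam) {u : Fin N → E}
    {c : Fin N → ℝ} (hne : (⋂ i, halfSpace (u i) (c i)).Nonempty) {y : ℕ → E} {n : ℕ → ℕ}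
    (hy : Bornology.IsBounded (Set.range y)) (hn : Tendsto n atTop atTop)
    (hsum : ∀ m, Summable fun k => contractionFactor lam m (n k)) {K : Submodule ℝ E} {p : E}
    (hK : K ≤ faceDirection u c (metricProj (⋂ i, halfSpace (u i) (c i)) p)) :
    HasSummableDrift (hlwbSweep lam (fun i => halfSpace (u i) (c i)) y n) K p := by
  have hC := isNonemptyClosedConvex_halfSpace_of_iInter hne
  exact hasSummableDrift_hlwbSweep hlam hC hne hy hn hsum
    (eventually_starProjection_sub_metricProj_halfSpace_eq_zero hK
      (Set.mem_iInter.1 ((IsNonemptyClosedConvex.iInter hC hne).metricProj_mem p)))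

theorem exists_tendsto_fixedPoint_hlwbSweep_comp (hlam : IsSteeringSequence N lam)
    {u v : Fin N → E} {α β : Fin N → ℝ} (hA : (⋂ i, halfSpace (u i) (α i)).Nonempty)
    (hB : (⋂ i, halfSpace (v i) (β i)).Nonempty) {s t : ℕ → E} {m n : ℕ → ℕ}
    (hs : Bornology.IsBounded (Set.range s)) (ht : Bornology.IsBounded (Set.range t))
    (hm : Tendsto m atTop atTop) (hn : Tendsto n atTop atTop)
    (hmsum : ∀ j, Summable fun k => contractionFactor lam j (m k))
    (hnsum : ∀ j, Summable fun k => contractionFactor lam j (n k)) {z : ℕ → E}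
    (hz : ∀ k, z (k + 1) = hlwbSweep lam (fun i => halfSpace (u i) (α i)) t n k
      (hlwbSweep lam (fun i => halfSpace (v i) (β i)) s m k (z k))) :
    ∃ p ∈ Function.fixedPoints (metricProj (⋂ i, halfSpace (u i) (α i)) ∘
      metricProj (⋂ i, halfSpace (v i) (β i))), Tendsto z atTop (𝓝 p) := by
  have hCA := isNonemptyClosedConvex_halfSpace_of_iInter hA
  have hCB := isNonemptyClosedConvex_halfSpace_of_iInter hB
  have hIA := IsNonemptyClosedConvex.iInter hCA hA
  have hIB := IsNonemptyClosedConvex.iInter hCB hB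
  obtain ⟨p₀, hp₀⟩ := exists_isBestApproxPair_iInter_halfSpace hA hB
  have hQA := lipschitzWith_hlwbSweep (y := t) (n := n) hlam hCA
  have hQB := lipschitzWith_hlwbSweep (y := s) (n := m) hlam hCB
  have hQAlim := tendsto_hlwbSweep hlam hCA hA ht hn
  have hQBlim := tendsto_hlwbSweep hlam hCB hB hs hm
  set PA := metricProj (⋂ i, halfSpace (u i) (α i))
  set PB := metricProj (⋂ i, halfSpace (v i) (β i))
  refine exists_tendsto_fixedPoint_of_summable_drift
    (c := fun p => (activeSet u α p).ncard + (activeSet v β (PB p)).ncard)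
    (K := fun p => faceDirection u α p ⊓ faceDirection v β (PB p))
    (fun k => ((hQA k).comp (hQB k)).weaken (one_mul 1).le)
    (fun x => tendsto_apply_of_lipschitzWith hQA (hQAlim (PB x)) (hQBlim x))
    (isParacontracting_metricProj_comp hIA hIB) ⟨_, isFixedPt_of_isBestApproxPair hIA hIB hp₀⟩
    (fun p hp => ?_) (fun p hp => ?_) hz
  · have hfix : PA (PB p) = p := hp
    exact (hasSummableDrift_hlwbSweep_halfSpace hlam hB hs hm hmsum inf_le_right).comp
      (hasSummableDrift_hlwbSweep_halfSpace hlam hA ht hn hnsum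
        (inf_le_left.trans (congrArg (faceDirection u α) hfix.symm).le))
      hQB (hQBlim p)
  · have hface := eventually_sub_mem_faceDirection (u := u) (c := α) (v := v) (d := β) (x := p)
      hIB.lipschitzWith_metricProj.continuous.continuousAt
    filter_upwards [self_mem_nhdsWithin, nhdsWithin_le_nhds hface] with q hq h hcard
    obtain ⟨hu, hv⟩ := h hcard
    exact ⟨hu, metricProj_sub_metricProj_of_isFixedPt hIA hIB hp hq ▸ hv⟩

theorem theorem1_general (A B : Fin N → Set E)
    (hA : ∀ i, IsClosedHalfSpace (A i) ∨ A i = Set.univ)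
    (hB : ∀ i, IsClosedHalfSpace (B i) ∨ B i = Set.univ)
    (hAne : (⋂ i, A i).Nonempty) (hBne : (⋂ i, B i).Nonempty)
    (hlam : IsSteeringSequence N lam) (nk : ℕ → ℕ) (hnk_lim : Tendsto nk atTop atTop)
    (hnk_sum : ∀ m, Summable fun k => contractionFactor lam m (nk k)) (a' b' : ℕ → E)
    (haux : Bornology.IsBounded (Set.range fun k : ℕ => (a' (2 * k), b' (2 * k + 1))))
    (a b : ℕ → E) (hrun : IsAlternatingHLWB lam nk A B a' b' a b) :
    ∃ p : E × E, IsBestApproxPair (⋂ i, A i) (⋂ i, B i) p ∧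
      Tendsto (fun k : ℕ => (a (2 * k), b (2 * k + 1))) atTop (𝓝 p) := by
  obtain ⟨u, α, rfl⟩ := exists_eq_halfSpace hA
  obtain ⟨v, β, rfl⟩ := exists_eq_halfSpace hB
  have hCA := isNonemptyClosedConvex_halfSpace_of_iInter (u := u) (c := α) hAne
  have hCB := isNonemptyClosedConvex_halfSpace_of_iInter (u := v) (c := β) hBne
  have heven : StrictMono fun k : ℕ => 2 * k := strictMono_mul_left_of_pos two_pos
  have hodd : StrictMono fun k : ℕ => 2 * k + 1 := heven.add_const 1
  have hs : Bornology.IsBounded (Set.range fun k => a' (2 * k)) := by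
    simpa only [← Set.range_comp, Function.comp_def] using haux.image_fst
  have ht : Bornology.IsBounded (Set.range fun k => b' (2 * k + 1)) := by
    simpa only [← Set.range_comp, Function.comp_def] using haux.image_snd
  have hmlim := hnk_lim.comp heven.tendsto_atTop
  have ha : ∀ k, a (2 * (k + 1)) = hlwb lam _ (b (2 * k + 1)) (b' (2 * k + 1)) (nk (2 * k + 1)) :=
    fun k => hrun.2 (2 * k + 1) (odd_two_mul_add_one k)
  have hb : ∀ k, b (2 * k + 1) = hlwb lam _ (a (2 * k)) (a' (2 * k)) (nk (2 * k)) :=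
    fun k => hrun.1 (2 * k) (even_two_mul k)
  obtain ⟨p, hp, hlim⟩ := exists_tendsto_fixedPoint_hlwbSweep_comp hlam hAne hBne hs ht hmlim
    (hnk_lim.comp hodd.tendsto_atTop) (fun j => (hnk_sum j).comp_injective heven.injective)
    (fun j => (hnk_sum j).comp_injective hodd.injective) (z := fun k => a (2 * k))
    fun k => (ha k).trans (by rw [hb]; rfl)
  refine ⟨_, isBestApproxPair_of_isFixedPt (.iInter hCA hAne) (.iInter hCB hBne) hp,
    hlim.prodMk_nhds ?_⟩
  exact (tendsto_apply_of_lipschitzWith (lipschitzWith_hlwbSweep hlam hCB)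
    (tendsto_hlwbSweep hlam hCB hBne hs hmlim p) hlim).congr fun k => (hb k).symm

end AlternatingSweeps

theorem theorem1 {d N : ℕ} [NeZero N]
    (A B : Fin N → Set (EuclideanSpace ℝ (Fin d)))
    (hA : ∀ i, IsClosedHalfSpace (A i) ∨ A i = Set.univ)
    (hB : ∀ i, IsClosedHalfSpace (B i) ∨ B i = Set.univ)
    (hAne : (⋂ i, A i).Nonempty) (hBne : (⋂ i, B i).Nonempty)
    (lam : ℕ → ℝ)
    (hlam01 : ∀ n, 1 ≤ n → 0 ≤ lam n ∧ lam n ≤ 1)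
    (hlam_lim : Tendsto lam atTop (𝓝 0))
    (hlam_sum : Tendsto (fun m => ∑ n ∈ Finset.Icc 1 m, lam n) atTop atTop)
    (hlam_var : Summable fun n => |lam (n + 1) - lam (n + 1 + N)|)
    (nk : ℕ → ℕ) (hnk_mono : Monotone nk) (hnk_lim : Tendsto nk atTop atTop)
    (hnk_iter : (⨆ k₀ : ℕ, ∑' k : Set.Ioi k₀,
        ENNReal.ofReal (∏ n ∈ Finset.Ioc (nk k₀) (nk k), (1 - lam n))) < ⊤)
    (a' b' : ℕ → EuclideanSpace ℝ (Fin d))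
    (haux : Bornology.IsBounded (Set.range fun k : ℕ => (a' (2 * k), b' (2 * k + 1))))
    (a b : ℕ → EuclideanSpace ℝ (Fin d))
    (hrun : IsAlternatingHLWB lam nk A B a' b' a b) :
    ∃ p : EuclideanSpace ℝ (Fin d) × EuclideanSpace ℝ (Fin d),
      IsBestApproxPair (⋂ i, A i) (⋂ i, B i) p ∧
      Tendsto (fun k : ℕ => (a (2 * k), b (2 * k + 1))) atTop (𝓝 p) := by
  have hlam : IsSteeringSequence N lam := ⟨hlam01, hlam_lim, hlam_sum, hlam_var⟩
  exact theorem1_general A B hA hB hAne hBne hlam nk hnk_lim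
    (summable_contractionFactor hlam.mem_Icc hnk_mono hnk_lim hnk_iter) a' b' haux a b hrun
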